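/- **Setting.** Consider the regression $y_t=z_t'a+x_t'b+\epsilon_t$, with $z_t\in\mathbb R^p$, $x_t\in\mathbb R^h$ ($p,h$ fixed), and put $X_t=(z_t',x_t')'$ and $X_{it}=(z_t',x_{it})'$ for $i=1,\dots,h$. Assume: 1. $E[\epsilon_t^2]<\infty$ and $\epsilon_t$ is a martingale difference with predetermined regressors: there is a filtration $(\mathcal F_t)$ such that $\epsilon_t$ is $\mathcal F_t$-measurable, $X_t$ is $\mathcal F_{t-1}$-measurable, and $E[\epsilon_t\mid\mathcal F_{t-1}]=0$; 2. for all sufficiently large $n$ the $n\times(p+h)$ matrix with rows $X_1',\dots,X_n'$ has full column rank $p+h$ almost surely; 3. the process $(X_t,\epsilon_t)$ is strictly stationary and ergodic, and the expectations $E[X_tX_t']$ and $\Lambda=E[\epsilon_t^2X_tX_t']$ exist and are finite. Let $\Gamma_{ij}=E[X_{it}X_{jt}']$, $\Lambda_{ij}=E[\epsilon_t^2X_{it}X_{jt}']$, $\Sigma_{ij}=\Gamma_{ii}^{-1}\Lambda_{ij}\Gamma_{jj}^{-1}$, let $S=[\Sigma_{ij}]_{i,j=1}^h$ be the block matrix with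 these blocks, let $R$ be the $h\times h(p+1)$ matrix whose $i$-th row selects the last coordinate of the $i$-th block, and let $V=RSR'$. Let $\widetilde\alpha_n=\big(\sum_{t=1}^n z_tz_t'\big)^{-1}\sum_{t=1}^n z_ty_t$ be the OLS estimator in the regression of $y_t$ on $z_t$ alone, $\widetilde u_t=y_t-z_t'\widetilde\alpha_n$ its residuals, $\widehat\Gamma_{ij}=n^{-1}\sum_{t=1}^nX_{it}X_{jt}'$, $\widetilde\Lambda_{ij}=n^{-1}\sum_{t=1}^n\widetilde u_t^2X_{it}X_{jt}'$, $\widetilde\Sigma_{ij}=\widehat\Gamma_{ii}^{-1}\widetilde\Lambda_{ij}\widehat\Gamma_{jj}^{-1}$, and $\widetilde V_n=R\,[\widetilde\Sigma_{ij}]_{i,j=1}^h\,R'$. **Proposition.** As $n\to\infty$: - under $H_0:b=0$, $\widetilde V_n\to V$ in probability; - under $H_1:b\neq0$, if moreover $E|X_{t,k}|^4<\infty$ for every coordinate $k$ of $X_t$, there is a matrix $\bar V$ such that $\widetilde V_n\to\bar V$ in probability, and $\bar V$ is positive definite if $\Lambda$ is positive definite. -/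

import Mathlib

open MeasureTheory Filter

noncomputable section

namespace MaxTest

variable {Ω : Type*} {p h : ℕ}

/-! Observations are numbered from `0`: the sample of size `n` consists of the times `t < n`.
`z t ω`, `x t ω`, `y t ω`, `ε t ω` are the values at time `t` of the two groups of regressors,
of the dependent variable and of the error term. -/

/-- The full regressor vector `X_t = [z_t', x_t']'`. -/
def fullReg (z : ℕ → Ω → Fin p → ℝ) (x : ℕ → Ω → Fin h → ℝ) (t : ℕ) (ω : Ω) :
    Fin p ⊕ Fin h → ℝ :=
  Sum.elim (z t ω) (x t ω)

/-- The regressor vector `X_{it} = [z_t', x_{it}]'` of the `i`-th parsimonious regression. -/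
def parsReg (z : ℕ → Ω → Fin p → ℝ) (x : ℕ → Ω → Fin h → ℝ) (i : Fin h) (t : ℕ) (ω : Ω) :
    Fin p ⊕ Unit → ℝ :=
  Sum.elim (z t ω) (fun _ => x t ω i)

/-- The `n × (p + h)` matrix of regressors, with rows `X_t'`. -/
def designMatrix (z : ℕ → Ω → Fin p → ℝ) (x : ℕ → Ω → Fin h → ℝ) (n : ℕ) (ω : Ω) :
    Matrix (Fin n) (Fin p ⊕ Fin h) ℝ :=
  Matrix.of fun t k => fullReg z x t ω k

/-! ### The selection matrix and the sandwich form -/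

/-- The `h × h(p+1)` matrix `R`; a column index `(j, k)` is the position `k` in the block `j`, and
`k = Sum.inr ()` is the last position of a block. -/
def selMatrix (p h : ℕ) : Matrix (Fin h) (Fin h × (Fin p ⊕ Unit)) ℝ :=
  Matrix.of fun i jk => if jk = (i, Sum.inr ()) then 1 else 0

/-- The block matrix `S = [Σ_{ij}]` with blocks `Σ_{ij} = Γ_{ii}⁻¹ Λ_{ij} Γ_{jj}⁻¹`. -/
def sandwichMatrix (Γ Λ : Fin h → Fin h → Matrix (Fin p ⊕ Unit) (Fin p ⊕ Unit) ℝ) :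
    Matrix (Fin h × (Fin p ⊕ Unit)) (Fin h × (Fin p ⊕ Unit)) ℝ :=
  Matrix.of fun ik jl => ((Γ ik.1 ik.1)⁻¹ * Λ ik.1 jl.1 * (Γ jl.1 jl.1)⁻¹) ik.2 jl.2

/-! ### Population quantities

All expectations are taken at time `0`; under strict stationarity they do not depend on the
time. -/

/-- `Γ_{ij} = E[X_{it} X_{jt}']`. -/
def popGamma [MeasurableSpace Ω] (μ : Measure Ω) (z : ℕ → Ω → Fin p → ℝ) (x : ℕ → Ω → Fin h → ℝ)
    (i j : Fin h) : Matrix (Fin p ⊕ Unit) (Fin p ⊕ Unit) ℝ :=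
  Matrix.of fun k l => ∫ ω, parsReg z x i 0 ω k * parsReg z x j 0 ω l ∂μ

/-- `Λ_{ij} = E[ε_t² X_{it} X_{jt}']`. -/
def popLambda [MeasurableSpace Ω] (μ : Measure Ω) (z : ℕ → Ω → Fin p → ℝ)
    (x : ℕ → Ω → Fin h → ℝ) (ε : ℕ → Ω → ℝ) (i j : Fin h) :
    Matrix (Fin p ⊕ Unit) (Fin p ⊕ Unit) ℝ :=
  Matrix.of fun k l => ∫ ω, ε 0 ω ^ 2 * (parsReg z x i 0 ω k * parsReg z x j 0 ω l) ∂μ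

/-- `Λ = E[ε_t² X_t X_t']`, for the full regressor vector. -/
def popLambdaFull [MeasurableSpace Ω] (μ : Measure Ω) (z : ℕ → Ω → Fin p → ℝ)
    (x : ℕ → Ω → Fin h → ℝ) (ε : ℕ → Ω → ℝ) : Matrix (Fin p ⊕ Fin h) (Fin p ⊕ Fin h) ℝ :=
  Matrix.of fun k l => ∫ ω, ε 0 ω ^ 2 * (fullReg z x 0 ω k * fullReg z x 0 ω l) ∂μ

/-- `V = R S R'`. -/
def popV [MeasurableSpace Ω] (μ : Measure Ω) (z : ℕ → Ω → Fin p → ℝ) (x : ℕ → Ω → Fin h → ℝ)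
    (ε : ℕ → Ω → ℝ) : Matrix (Fin h) (Fin h) ℝ :=
  selMatrix p h * sandwichMatrix (popGamma μ z x) (popLambda μ z x ε) * (selMatrix p h).transpose

/-! ### The estimator -/

/-- The OLS estimator of `α` in the regression `y_t = z_t' α + ε_t`, `t < n`:
`(∑ z_t z_t')⁻¹ ∑ z_t y_t`. -/
def restrictedOLS (z : ℕ → Ω → Fin p → ℝ) (y : ℕ → Ω → ℝ) (n : ℕ) (ω : Ω) : Fin p → ℝ :=
  (∑ t ∈ Finset.range n, Matrix.vecMulVec (z t ω) (z t ω))⁻¹.mulVec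
    (∑ t ∈ Finset.range n, y t ω • z t ω)

/-- The restricted residual at time `t` from the sample of size `n`: `y_t` minus its fitted
value. -/
def restrictedResid (z : ℕ → Ω → Fin p → ℝ) (y : ℕ → Ω → ℝ) (n t : ℕ) (ω : Ω) : ℝ :=
  y t ω - z t ω ⬝ᵥ restrictedOLS z y n ω

/-- The sample moment `n⁻¹ ∑_t X_{it} X_{jt}'`. -/
def sampleGamma (z : ℕ → Ω → Fin p → ℝ) (x : ℕ → Ω → Fin h → ℝ) (n : ℕ) (ω : Ω)
    (i j : Fin h) : Matrix (Fin p ⊕ Unit) (Fin p ⊕ Unit) ℝ :=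
  (n : ℝ)⁻¹ • ∑ t ∈ Finset.range n,
    Matrix.vecMulVec (parsReg z x i t ω) (parsReg z x j t ω)

/-- The sample moment `n⁻¹ ∑_t ũ_t² X_{it} X_{jt}'`, with `ũ_t` the restricted residuals. -/
def sampleLambda (z : ℕ → Ω → Fin p → ℝ) (x : ℕ → Ω → Fin h → ℝ) (y : ℕ → Ω → ℝ) (n : ℕ) (ω : Ω)
    (i j : Fin h) : Matrix (Fin p ⊕ Unit) (Fin p ⊕ Unit) ℝ :=
  (n : ℝ)⁻¹ • ∑ t ∈ Finset.range n,
    restrictedResid z y n t ω ^ 2 • Matrix.vecMulVec (parsReg z x i t ω) (parsReg z x j t ω)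

/-- The estimator `Ṽ_n = R S̃ R'`. -/
def estV (z : ℕ → Ω → Fin p → ℝ) (x : ℕ → Ω → Fin h → ℝ) (y : ℕ → Ω → ℝ) (n : ℕ) (ω : Ω) :
    Matrix (Fin h) (Fin h) ℝ :=
  selMatrix p h * sandwichMatrix (sampleGamma z x n ω) (sampleLambda z x y n ω) *
    (selMatrix p h).transpose

/-! ### Assumptions -/

/-- A process with values in `E`, seen as one random sequence, is strictly stationary and ergodic:
the shift preserves its law and is ergodic for it. -/
def IsStationaryErgodic [MeasurableSpace Ω] {E : Type*} [MeasurableSpace E] (μ : Measure Ω)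
    (w : ℕ → Ω → E) : Prop :=
  Ergodic (fun (s : ℕ → E) (t : ℕ) => s (t + 1)) (μ.map fun ω t => w t ω)

/-- The standing assumptions on the regression model `y_t = z_t' a + x_t' b + ε_t`. -/
structure Assumptions [MeasurableSpace Ω] (μ : Measure Ω) (z : ℕ → Ω → Fin p → ℝ)
    (x : ℕ → Ω → Fin h → ℝ) (ε y : ℕ → Ω → ℝ) (a : Fin p → ℝ) (b : Fin h → ℝ) : Prop where
  model : ∀ t ω, y t ω = z t ω ⬝ᵥ a + x t ω ⬝ᵥ b + ε t ω
  measurable_z : ∀ t, Measurable (z t)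
  measurable_x : ∀ t, Measurable (x t)
  measurable_err : ∀ t, Measurable (ε t)
  /-- The error has a finite second moment. -/
  memLp_err : ∀ t, MemLp (ε t) 2 μ
  /-- The error is a martingale difference, and the regressors are predetermined. The
  `σ`-algebra `𝓕 t` is the information available just before the error at time `t` realizes. -/
  martingaleDiff : ∃ 𝓕 : Filtration ℕ ‹MeasurableSpace Ω›,
    (∀ t, Measurable[𝓕 t] (z t)) ∧ (∀ t, Measurable[𝓕 t] (x t)) ∧
      (∀ t, Measurable[𝓕 (t + 1)] (ε t)) ∧ ∀ t, μ[ε t | 𝓕 t] =ᵐ[μ] 0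
  /-- The matrix of regressors has full column rank almost surely, in large samples. -/
  fullRank : ∀ᶠ n in atTop, ∀ᵐ ω ∂μ, (designMatrix z x n ω).rank = p + h
  /-- Regressors and error are jointly strictly stationary and ergodic. -/
  stationaryErgodic : IsStationaryErgodic μ fun t ω => (fullReg z x t ω, ε t ω)
  /-- `E[X_t X_t']` exists. -/
  integrable_sq : ∀ t k l, Integrable (fun ω => fullReg z x t ω k * fullReg z x t ω l) μ
  /-- `E[ε_t² X_t X_t']` exists. -/
  integrable_err_sq : ∀ t k l,
    Integrable (fun ω => ε t ω ^ 2 * (fullReg z x t ω k * fullReg z x t ω l)) μ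

/-- Convergence in probability of a sequence of random matrices to a constant matrix. -/
def TendstoInProb [MeasurableSpace Ω] (μ : Measure Ω) {m : ℕ}
    (M : ℕ → Ω → Matrix (Fin m) (Fin m) ℝ) (L : Matrix (Fin m) (Fin m) ℝ) : Prop :=
  ∀ i j, TendstoInMeasure μ (fun n ω => M n ω i j) atTop fun _ => L i j

end MaxTest

end

/-!
Under either hypothesis there is a pseudo-true value `α` such that the restricted residuals are
`ũ_t = u_t - z_t'(α̃_n - α)` with `u_t = β'X_t + ε_t`: under `b = 0` take `α = a` and `β = 0`, and
in general `α = a + E[zz']⁻¹ E[zx'] b`, for which `E[u_t z_t] = 0`. The estimator is a function of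
the sample moments of `X_t` and of `ũ_t X_t` that is continuous where `E[X X']` is positive definite,
which follows from the full rank assumption (`Assumptions.posDef_momentMatrix`). So the limit is the
sandwich form in `E[X X']` and `E[u² X X']`, provided that `ũ_t` can be replaced by `u_t`.

By the Cauchy–Schwarz inequality (`abs_sampleMoment_sub_le`) this holds as soon as
`n⁻¹ ∑ (z_t'(α̃_n - α))² |X_t|² → 0` in probability. With fourth moments this is the consistency of
`α̃_n` and the law of large numbers. When `b = 0` only second moments are available; then
`|α̃_n - α|²` is of order `n⁻¹` in probability, since the `z_t ε_t` are orthogonal, whereas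
`max_{t < n} |z_t|² = o(n)` by stationarity (`tendsto_iSup_div_probFilter`), and the product of
these two bounds vanishes.

The law of large numbers is the mean ergodic theorem: von Neumann's theorem in `L²`, with the fixed
space reduced to constants by ergodicity, extended to `L¹` by density
(`tendsto_eLpNorm_one_birkhoffAverage`). Convergence in probability to a constant is expressed as
convergence along a filter on `ℕ × Ω` (`probFilter`).

For positive definiteness, `E[u² X X'] = Λ + E[(β'X)² X X']`, the cross terms being zero by the
martingale difference property, and the sandwich form is `G' E[u² X X'] G` with an injective `G`
(`posDef_parsSandwich`).
-/

open Topology ENNReal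

namespace MaxTest

/-! ### The mean ergodic theorem for ergodic maps -/

section MeanErgodic

variable {α : Type*} [MeasurableSpace α] {ν : Measure α} {T : α → α} {f : α → ℝ}

theorem memLp_birkhoffSum {q : ℝ≥0∞} (hT : MeasurePreserving T ν ν) (hf : MemLp f q ν) (n : ℕ) :
    MemLp (birkhoffSum T f n) q ν := by
  have : birkhoffSum T f n = fun x => ∑ k ∈ Finset.range n, f (T^[k] x) := rfl
  rw [this]
  exact memLp_finsetSum _ fun k _ => hf.comp_measurePreserving (hT.iterate k)

theorem memLp_birkhoffAverage {q : ℝ≥0∞} (hT : MeasurePreserving T ν ν) (hf : MemLp f q ν)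
    (n : ℕ) : MemLp (birkhoffAverage ℝ T f n) q ν :=
  (memLp_birkhoffSum hT hf n).const_smul ((n : ℝ)⁻¹)

theorem integral_birkhoffAverage (hT : MeasurePreserving T ν ν) (hf : Integrable f ν) {n : ℕ}
    (hn : n ≠ 0) : ∫ x, birkhoffAverage ℝ T f n x ∂ν = ∫ x, f x ∂ν := by
  have hk (k : ℕ) : ∫ x, f (T^[k] x) ∂ν = ∫ x, f x ∂ν := by
    have hTk := hT.iterate k
    rw [← integral_map hTk.aemeasurable (by rw [hTk.map_eq]; exact hf.1), hTk.map_eq]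
  simp only [birkhoffAverage, birkhoffSum, smul_eq_mul]
  rw [integral_const_mul, integral_finsetSum (f := fun k x => f (T^[k] x)) _
    fun k _ => (hT.iterate k).integrable_comp_of_integrable hf]
  simp only [hk, Finset.sum_const, Finset.card_range, nsmul_eq_mul]
  field_simp

theorem eLpNorm_birkhoffAverage_le {q : ℝ≥0∞} (hq : 1 ≤ q) (hT : MeasurePreserving T ν ν)
    (hf : MemLp f q ν) (n : ℕ) : eLpNorm (birkhoffAverage ℝ T f n) q ν ≤ eLpNorm f q ν := by
  have hcomp (k : ℕ) : MemLp (fun x => f (T^[k] x)) q ν :=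
    hf.comp_measurePreserving (hT.iterate k)
  have hsum : eLpNorm (birkhoffSum T f n) q ν ≤ n * eLpNorm f q ν := by
    have : birkhoffSum T f n = ∑ k ∈ Finset.range n, fun x => f (T^[k] x) := by
      ext x; simp [birkhoffSum]
    rw [this]
    refine (eLpNorm_sum_le (fun k _ => (hcomp k).1) hq).trans (le_of_eq ?_)
    have hk (k : ℕ) : eLpNorm (fun x => f (T^[k] x)) q ν = eLpNorm f q ν :=
      eLpNorm_comp_measurePreserving hf.1 (hT.iterate k)
    simp [hk]
  have : birkhoffAverage ℝ T f n = (n : ℝ)⁻¹ • birkhoffSum T f n := rfl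
  rw [this, eLpNorm_const_smul]
  rcases eq_or_ne n 0 with rfl | hn
  · simp
  · grw [hsum, ← mul_assoc]
    rw [enorm_inv (by positivity), Real.enorm_natCast, ENNReal.inv_mul_cancel (by simpa) (by simp),
      one_mul]

/-- The mean ergodic theorem in `L²`, with the limit identified by ergodicity: the fixed space of
the Koopman operator consists of constants. -/
theorem tendsto_eLpNorm_two_birkhoffAverage [IsProbabilityMeasure ν] (hT : Ergodic T ν)
    (hf : MemLp f 2 ν) :
    Tendsto (fun n => eLpNorm (fun x => birkhoffAverage ℝ T f n x - ∫ y, f y ∂ν) 2 ν) atTop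
      (𝓝 0) := by
  have hTm := hT.toMeasurePreserving
  set U : Lp ℝ 2 ν →L[ℝ] Lp ℝ 2 ν :=
    (Lp.compMeasurePreservingₗᵢ ℝ T hTm).toContinuousLinearMap with hU
  have hiter (k : ℕ) : U^[k] (hf.toLp f) =
      (hf.comp_measurePreserving (hTm.iterate k)).toLp _ := by
    have : (U : Lp ℝ 2 ν → Lp ℝ 2 ν) = Lp.compMeasurePreserving T hTm := rfl
    rw [this, Lp.compMeasurePreserving_iterate, Lp.toLp_compMeasurePreserving]
  have hsum (n : ℕ) : birkhoffSum U _root_.id n (hf.toLp f) =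
      (memLp_birkhoffSum hTm hf n).toLp _ := by
    induction n with
    | zero =>
      rw [birkhoffSum_zero, MemLp.toLp_congr (memLp_birkhoffSum hTm hf 0) (MemLp.zero' (ε := ℝ))
        (ae_of_all _ fun x => birkhoffSum_zero T f x)]
      exact (MemLp.toLp_zero _).symm
    | succ n ih =>
      rw [birkhoffSum_succ, ih, _root_.id, hiter, ← MemLp.toLp_add]
      refine MemLp.toLp_congr _ _ (ae_of_all _ fun x => ?_)
      simp [birkhoffSum_succ]
  have havg (n : ℕ) : birkhoffAverage ℝ U _root_.id n (hf.toLp f) =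
      (memLp_birkhoffAverage hTm hf n).toLp _ := by
    rw [birkhoffAverage, hsum, ← MemLp.toLp_const_smul]
    rfl
  have hlim := U.tendsto_birkhoffAverage_orthogonalProjection
    (LinearIsometry.norm_toContinuousLinearMap_le _) (hf.toLp f)
  set P := (U.eqLocus (1 : Lp ℝ 2 ν →L[ℝ] Lp ℝ 2 ν)).orthogonalProjectionOnto (hf.toLp f)
  -- The limit is invariant, hence constant by ergodicity.
  obtain ⟨c, hc⟩ : ∃ c : ℝ, (P : Lp ℝ 2 ν) =ᵐ[ν] Function.const α c := by
    have hP : U (P : Lp ℝ 2 ν) = P := P.2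
    refine hT.ae_eq_const_of_ae_eq_comp_ae (Lp.aestronglyMeasurable _) ?_
    have h1 := Lp.coeFn_compMeasurePreserving (P : Lp ℝ 2 ν) hTm
    have h2 : Lp.compMeasurePreserving T hTm (P : Lp ℝ 2 ν) = P := hP
    rw [h2] at h1
    exact h1.symm
  have hconv : Tendsto (fun n => eLpNorm (fun x => birkhoffAverage ℝ T f n x - c) 2 ν) atTop
      (𝓝 0) := by
    rw [Lp.tendsto_Lp_iff_tendsto_eLpNorm'] at hlim
    refine hlim.congr fun n => eLpNorm_congr_ae ?_
    rw [havg]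
    filter_upwards [hc, (memLp_birkhoffAverage hTm hf n).coeFn_toLp] with x h1 h2
    simp [h1, h2]
  -- Averaging preserves the integral, which identifies the constant.
  have hint : Tendsto (fun n => ∫ x, birkhoffAverage ℝ T f n x ∂ν) atTop (𝓝 (∫ _, c ∂ν)) := by
    refine tendsto_integral_of_L1' _ aestronglyMeasurable_const
      (.of_forall fun n => (memLp_birkhoffAverage hTm hf n).integrable one_le_two) ?_
    refine tendsto_of_tendsto_of_tendsto_of_le_of_le tendsto_const_nhds hconv
      (fun _ => zero_le) fun n => ?_
    exact eLpNorm_le_eLpNorm_of_exponent_le one_le_two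
      ((memLp_birkhoffAverage hTm hf n).1.sub aestronglyMeasurable_const)
  have hcf : ∫ x, f x ∂ν = c := by
    have hconst : Tendsto (fun n => ∫ x, birkhoffAverage ℝ T f n x ∂ν) atTop
        (𝓝 (∫ x, f x ∂ν)) := by
      refine tendsto_const_nhds.congr' ?_
      filter_upwards [eventually_ne_atTop 0] with n hn
      rw [integral_birkhoffAverage hTm (hf.integrable one_le_two) hn]
    simpa using tendsto_nhds_unique hconst hint
  rwa [hcf]

/-- The mean ergodic theorem in `L¹`, by approximation from `L²`. -/
theorem tendsto_eLpNorm_one_birkhoffAverage [IsProbabilityMeasure ν] (hT : Ergodic T ν)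
    (hf : Integrable f ν) :
    Tendsto (fun n => eLpNorm (fun x => birkhoffAverage ℝ T f n x - ∫ y, f y ∂ν) 1 ν) atTop
      (𝓝 0) := by
  have hTm := hT.toMeasurePreserving
  rw [ENNReal.tendsto_nhds_zero]
  intro δ hδ
  obtain ⟨g, hfg, hg, hg2⟩ :
      ∃ g : α → ℝ, eLpNorm (f - g) 1 ν < δ / 3 ∧ MemLp g 1 ν ∧ MemLp g 2 ν := by
    obtain ⟨g, hfg, hg⟩ := (memLp_one_iff_integrable.2 hf).exists_simpleFunc_eLpNorm_sub_lt
      ENNReal.one_ne_top (ε := δ / 3) (ENNReal.div_pos hδ.ne' (by simp)).ne'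
    exact ⟨g, hfg, hg, g.memLp_of_isFiniteMeasure 2 ν⟩
  have hfgL : MemLp (f - g) 1 ν := (memLp_one_iff_integrable.2 hf).sub hg
  have hgl := tendsto_eLpNorm_two_birkhoffAverage hT hg2
  rw [ENNReal.tendsto_nhds_zero] at hgl
  filter_upwards [hgl (δ / 3) (ENNReal.div_pos hδ.ne' (by simp))] with n hn
  have hdecomp : (fun x => birkhoffAverage ℝ T f n x - ∫ y, f y ∂ν) =
      birkhoffAverage ℝ T (f - g) n + (fun x => birkhoffAverage ℝ T g n x - ∫ y, g y ∂ν) +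
        fun _ => -∫ y, (f - g) y ∂ν := by
    ext x
    have : ∫ y, (f - g) y ∂ν = ∫ y, f y ∂ν - ∫ y, g y ∂ν :=
      integral_sub hf (memLp_one_iff_integrable.1 hg)
    rw [this]
    simp [birkhoffAverage_sub]
  have hm1 := (memLp_birkhoffAverage hTm hfgL n).1
  have hm2 : AEStronglyMeasurable (fun x => birkhoffAverage ℝ T g n x - ∫ y, g y ∂ν) ν :=
    (memLp_birkhoffAverage hTm hg2 n).1.sub aestronglyMeasurable_const
  rw [hdecomp]
  calc
    _ ≤ eLpNorm (birkhoffAverage ℝ T (f - g) n) 1 ν +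
          eLpNorm (fun x => birkhoffAverage ℝ T g n x - ∫ y, g y ∂ν) 1 ν +
          eLpNorm (fun _ => -∫ y, (f - g) y ∂ν) 1 ν :=
      (eLpNorm_add_le (hm1.add hm2) aestronglyMeasurable_const le_rfl).trans
        (add_le_add (eLpNorm_add_le hm1 hm2 le_rfl) le_rfl)
    _ ≤ δ / 3 + δ / 3 + δ / 3 := by
      gcongr
      · exact (eLpNorm_birkhoffAverage_le le_rfl hTm hfgL n).trans hfg.le
      · exact (eLpNorm_le_eLpNorm_of_exponent_le one_le_two hm2).trans hn
      · refine le_trans ?_ hfg.le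
        rw [eLpNorm_const _ one_ne_zero (IsProbabilityMeasure.ne_zero ν),
          eLpNorm_one_eq_lintegral_enorm]
        simpa [-Pi.sub_apply] using enorm_integral_le_lintegral_enorm (f - g : α → ℝ)
    _ = δ := ENNReal.add_thirds δ

end MeanErgodic

/-! ### Convergence in probability as convergence along a filter -/

section ProbFilter

variable {Ω : Type*} [MeasurableSpace Ω] {μ : Measure Ω}

/-- The filter on `ℕ × Ω` generated by the events whose probability tends to one. A sequence of
random elements, seen as a function on `ℕ × Ω`, tends to a constant along this filter exactly when
it does so in probability, so that the general theory of limits along filters (algebraic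
operations, continuous mappings, squeezing) applies to convergence in probability. -/
def probFilter (μ : Measure Ω) : Filter (ℕ × Ω) where
  sets := {S | Tendsto (fun n => μ {ω | (n, ω) ∉ S}) atTop (𝓝 0)}
  univ_sets := by simp
  sets_of_superset {S S'} hS hSS' :=
    tendsto_of_tendsto_of_tendsto_of_le_of_le tendsto_const_nhds hS (fun _ => zero_le)
      fun _ => measure_mono fun _ hω h => hω (hSS' h)
  inter_sets {S S'} hS hS' := by
    refine tendsto_of_tendsto_of_tendsto_of_le_of_le tendsto_const_nhds
      (by simpa using hS.add hS') (fun _ => zero_le) fun n => ?_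
    refine le_trans (measure_mono fun ω hω => ?_) (measure_union_le _ _)
    by_cases h : (n, ω) ∈ S
    · exact Or.inr fun h' => hω ⟨h, h'⟩
    · exact Or.inl h

theorem eventually_probFilter {P : ℕ × Ω → Prop} :
    (∀ᶠ q in probFilter μ, P q) ↔ Tendsto (fun n => μ {ω | ¬ P (n, ω)}) atTop (𝓝 0) :=
  Iff.rfl

theorem eventually_probFilter_of_ae {P : ℕ × Ω → Prop}
    (hP : ∀ᶠ n in atTop, ∀ᵐ ω ∂μ, P (n, ω)) : ∀ᶠ q in probFilter μ, P q := by
  rw [eventually_probFilter]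
  refine tendsto_const_nhds.congr' ?_
  filter_upwards [hP] with n hn
  exact (ae_iff.1 hn).symm

theorem tendsto_fst_probFilter : Tendsto Prod.fst (probFilter μ) atTop := by
  intro S hS
  refine eventually_probFilter_of_ae ?_
  filter_upwards [hS] with n hn
  exact ae_of_all _ fun _ => hn

theorem tendstoInMeasure_const_iff {f : ℕ → Ω → ℝ} {c : ℝ} :
    TendstoInMeasure μ f atTop (fun _ => c) ↔
      Tendsto (fun q : ℕ × Ω => f q.1 q.2) (probFilter μ) (𝓝 c) := by
  rw [tendstoInMeasure_iff_dist, Metric.tendsto_nhds]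
  simp only [eventually_probFilter, not_lt, gt_iff_lt]

theorem tendsto_probFilter_of_eLpNorm {f : ℕ → Ω → ℝ} {c : ℝ}
    (hf : ∀ n, AEStronglyMeasurable (f n) μ)
    (h : Tendsto (fun n => eLpNorm (fun ω => f n ω - c) 1 μ) atTop (𝓝 0)) :
    Tendsto (fun q : ℕ × Ω => f q.1 q.2) (probFilter μ) (𝓝 c) :=
  tendstoInMeasure_const_iff.1 <|
    tendstoInMeasure_of_tendsto_eLpNorm one_ne_zero hf aestronglyMeasurable_const h

/-- A sequence that tends to zero in probability still does so after multiplication by a sequence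
that is bounded in mean. -/
theorem tendsto_probFilter_mul_of_integral_le [IsFiniteMeasure μ] {m : ℕ × Ω → ℝ}
    {s : ℕ → Ω → ℝ} {C : ℝ} (hm : Tendsto m (probFilter μ) (𝓝 0)) (hs0 : ∀ n ω, 0 ≤ s n ω)
    (hsi : ∀ n, Integrable (s n) μ) (hsC : ∀ n, ∫ ω, s n ω ∂μ ≤ C) :
    Tendsto (fun q => m q * s q.1 q.2) (probFilter μ) (𝓝 0) := by
  rw [Metric.tendsto_nhds]
  intro δ hδ
  rw [eventually_probFilter, ENNReal.tendsto_nhds_zero]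
  intro e he
  obtain ⟨r, hr0, hre⟩ : ∃ r : ℝ, 0 < r ∧ ENNReal.ofReal r ≤ e / 2 := by
    obtain ⟨r, hr0, hr⟩ := ENNReal.lt_iff_exists_nnreal_btwn.1 (ENNReal.half_pos he.ne')
    exact ⟨r, by simpa using hr0, by simpa using hr.le⟩
  -- The bound in mean makes `s` exceed the level `K` with probability at most `r`.
  set K : ℝ := (|C| + 1) / r with hK
  have hK0 : 0 < K := by positivity
  have hsK (n : ℕ) : μ {ω | K ≤ s n ω} ≤ e / 2 := by
    refine le_trans ?_ hre
    have h1 := mul_meas_ge_le_integral_of_nonneg (ae_of_all μ (hs0 n)) (hsi n) K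
    have h2 : K * μ.real {ω | K ≤ s n ω} ≤ K * r := by
      have : K * r = |C| + 1 := by rw [hK]; field_simp
      linarith [hsC n, le_abs_self C]
    rw [← ENNReal.ofReal_toReal (measure_ne_top μ _)]
    exact ENNReal.ofReal_le_ofReal (le_of_mul_le_mul_left h2 hK0)
  have hm' := (Metric.tendsto_nhds.1 hm) (δ / K) (by positivity)
  rw [eventually_probFilter, ENNReal.tendsto_nhds_zero] at hm'
  filter_upwards [hm' (e / 2) (ENNReal.half_pos he.ne')] with n hn
  calc
    _ ≤ μ ({ω | ¬ dist (m (n, ω)) 0 < δ / K} ∪ {ω | K ≤ s n ω}) := by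
      refine measure_mono fun ω hω => ?_
      by_contra hcon
      simp only [Set.mem_union, Set.mem_ofPred_eq, not_or, not_not, not_le, dist_zero_right,
        Real.norm_eq_abs] at hcon hω
      refine hω ?_
      rw [abs_mul, abs_of_nonneg (hs0 n ω)]
      calc
        _ ≤ |m (n, ω)| * K := by gcongr; exact hcon.2.le
        _ < δ / K * K := by gcongr; exact hcon.1
        _ = δ := by field_simp
    _ ≤ _ := measure_union_le _ _
    _ ≤ e / 2 + e / 2 := add_le_add hn (hsK n)
    _ = e := ENNReal.add_halves e

end ProbFilter

/-! ### Sample means and maxima of stationary processes -/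

section Stationary

theorem shift_iterate_apply {E : Type*} (n : ℕ) (s : ℕ → E) (k : ℕ) :
    (fun (s : ℕ → E) (t : ℕ) => s (t + 1))^[n] s k = s (k + n) := by
  induction n generalizing s with
  | zero => rfl
  | succ n ih => rw [Function.iterate_succ_apply, ih]; rfl

variable {Ω E : Type*} [MeasurableSpace Ω] [MeasurableSpace E] {μ : Measure Ω}
  {w : ℕ → Ω → E}

theorem IsStationaryErgodic.identDistrib (hS : IsStationaryErgodic μ w)
    (hw : ∀ t, Measurable (w t)) (t : ℕ) : ProbabilityTheory.IdentDistrib (w t) (w 0) μ μ := by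
  refine ⟨(hw t).aemeasurable, (hw 0).aemeasurable, ?_⟩
  have hW : Measurable fun ω t => w t ω := measurable_pi_lambda _ hw
  have hmp := hS.toMeasurePreserving.iterate t
  have h0 : Measurable fun s : ℕ → E => s 0 := measurable_pi_apply 0
  have h1 : μ.map (w t) = ((μ.map fun ω t => w t ω).map
      (fun (s : ℕ → E) (t : ℕ) => s (t + 1))^[t]).map fun s => s 0 := by
    rw [Measure.map_map h0 hmp.measurable, Measure.map_map (h0.comp hmp.measurable) hW]
    congr 1
    ext ω
    simp [shift_iterate_apply]
  rw [h1, hmp.map_eq, Measure.map_map h0 hW]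
  rfl

/-- Sample means of a stationary ergodic process converge in probability. -/
theorem IsStationaryErgodic.tendsto_sampleMean [IsProbabilityMeasure μ]
    (hS : IsStationaryErgodic μ w) (hw : ∀ t, Measurable (w t)) {g : E → ℝ} (hg : Measurable g)
    (hgi : Integrable (fun ω => g (w 0 ω)) μ) :
    Tendsto (fun q : ℕ × Ω => (q.1 : ℝ)⁻¹ * ∑ t ∈ Finset.range q.1, g (w t q.2)) (probFilter μ)
      (𝓝 (∫ ω, g (w 0 ω) ∂μ)) := by
  have hW : Measurable fun ω t => w t ω := measurable_pi_lambda _ hw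
  have : IsProbabilityMeasure (μ.map fun ω t => w t ω) :=
    Measure.isProbabilityMeasure_map hW.aemeasurable
  have hg0 : Measurable fun s : ℕ → E => g (s 0) := hg.comp (measurable_pi_apply 0)
  have hint : Integrable (fun s : ℕ → E => g (s 0)) (μ.map fun ω t => w t ω) :=
    (integrable_map_measure hg0.aestronglyMeasurable hW.aemeasurable).2 hgi
  have hval : ∫ s : ℕ → E, g (s 0) ∂(μ.map fun ω t => w t ω) = ∫ ω, g (w 0 ω) ∂μ :=
    integral_map hW.aemeasurable hg0.aestronglyMeasurable
  have hlim := tendsto_eLpNorm_one_birkhoffAverage hS hint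
  rw [hval] at hlim
  refine tendsto_probFilter_of_eLpNorm
    (f := fun n ω => (n : ℝ)⁻¹ * ∑ t ∈ Finset.range n, g (w t ω)) (fun n => ?_) ?_
  · exact (measurable_const.mul (Finset.measurable_fun_sum _ fun t _ =>
      hg.comp (hw t))).aestronglyMeasurable
  · refine hlim.congr fun n => ?_
    have hb (s : ℕ → E) : birkhoffAverage ℝ (fun (s : ℕ → E) (t : ℕ) => s (t + 1))
        (fun s => g (s 0)) n s = (n : ℝ)⁻¹ * ∑ t ∈ Finset.range n, g (s t) := by
      simp [birkhoffAverage, birkhoffSum, shift_iterate_apply]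
    simp only [hb]
    refine eLpNorm_map_measure (g := fun s : ℕ → E =>
      (n : ℝ)⁻¹ * ∑ t ∈ Finset.range n, g (s t) - ∫ ω, g (w 0 ω) ∂μ) ?_ hW.aemeasurable
    exact ((measurable_const.mul (Finset.measurable_fun_sum _ fun t _ =>
      hg.comp (measurable_pi_apply t))).sub_const _).aestronglyMeasurable

/-- The maximum of `n` identically distributed integrable variables is `o(n)` in probability,
whatever their dependence: by the union bound and Markov's inequality on the tail, it exceeds
`η n` with probability at most `η⁻¹ E[f 1_{f ≥ η n}]`. -/
theorem tendsto_iSup_div_probFilter {f : ℕ → Ω → ℝ} (hf0 : ∀ t ω, 0 ≤ f t ω)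
    (hfm : ∀ t, Measurable (f t)) (hid : ∀ t, ProbabilityTheory.IdentDistrib (f t) (f 0) μ μ)
    (hfi : Integrable (f 0) μ) :
    Tendsto (fun q : ℕ × Ω => ⨆ t : Fin q.1, (q.1 : ℝ)⁻¹ * f t q.2) (probFilter μ) (𝓝 0) := by
  rw [Metric.tendsto_nhds]
  intro δ hδ
  obtain ⟨η, hη0, hηδ⟩ := exists_between hδ
  set A : ℕ → Set Ω := fun n => {ω | ENNReal.ofReal (η * n) ≤ ENNReal.ofReal (f 0 ω)} with hA
  have hAm (n : ℕ) : MeasurableSet (A n) :=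
    measurableSet_le measurable_const (hfm 0).ennreal_ofReal
  have hfin : ∫⁻ ω, ENNReal.ofReal (f 0 ω) ∂μ ≠ ∞ := by
    rw [← ofReal_integral_eq_lintegral_ofReal hfi (ae_of_all _ (hf0 0))]
    exact ENNReal.ofReal_ne_top
  have hAtail (n : ℕ) : ENNReal.ofReal (η * n) * μ (A n) ≤
      ∫⁻ ω in A n, ENNReal.ofReal (f 0 ω) ∂μ := by
    rw [← setLIntegral_const]
    exact setLIntegral_mono' (hAm n) fun ω hω => hω
  have hlev : Tendsto (fun n : ℕ => ENNReal.ofReal (η * n)) atTop (𝓝 ∞) :=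
    ENNReal.tendsto_ofReal_atTop.comp (tendsto_natCast_atTop_atTop.const_mul_atTop hη0)
  have hAμ : Tendsto (fun n => μ (A n)) atTop (𝓝 0) := by
    have h1 : Tendsto (fun n : ℕ => (∫⁻ ω, ENNReal.ofReal (f 0 ω) ∂μ) / ENNReal.ofReal (η * n))
        atTop (𝓝 0) := by
      simpa using ENNReal.Tendsto.const_div hlev (Or.inr hfin)
    refine tendsto_of_tendsto_of_tendsto_of_le_of_le' tendsto_const_nhds h1
      (.of_forall fun _ => zero_le) ?_
    filter_upwards [eventually_gt_atTop 0] with n hn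
    have : 0 < η * n := by positivity
    refine meas_ge_le_lintegral_div (hfm 0).ennreal_ofReal.aemeasurable
      (by simpa using this) ENNReal.ofReal_ne_top
  have htail := tendsto_setLIntegral_zero hfin hAμ
  have hbound : Tendsto (fun n => (ENNReal.ofReal η)⁻¹ * ∫⁻ ω in A n, ENNReal.ofReal (f 0 ω) ∂μ)
      atTop (𝓝 0) := by
    simpa using ENNReal.Tendsto.const_mul htail (Or.inr (by simpa using hη0))
  rw [eventually_probFilter]
  refine tendsto_of_tendsto_of_tendsto_of_le_of_le' tendsto_const_nhds hbound
      (.of_forall fun _ => zero_le) ?_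
  filter_upwards [eventually_gt_atTop 0] with n hn
  have hnR : (0 : ℝ) < n := by positivity
  have hsub : {ω | ¬ dist (⨆ t : Fin n, (n : ℝ)⁻¹ * f t ω) 0 < δ} ⊆
      ⋃ t ∈ Finset.range n, {ω | ENNReal.ofReal (η * n) ≤ ENNReal.ofReal (f t ω)} := by
    intro ω hω
    by_contra hcon
    simp only [Set.mem_iUnion, not_exists, Set.mem_ofPred_eq, Finset.mem_range, not_le] at hcon
    refine hω ?_
    have h0 : 0 ≤ ⨆ t : Fin n, (n : ℝ)⁻¹ * f t ω :=
      Real.iSup_nonneg fun t => mul_nonneg (by positivity) (hf0 _ _)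
    simp only [dist_zero_right, Real.norm_eq_abs, abs_of_nonneg h0]
    refine lt_of_le_of_lt (Real.iSup_le (fun t => ?_) hη0.le) hηδ
    have h1 := (ENNReal.ofReal_lt_ofReal_iff_of_nonneg (hf0 _ _)).1 (hcon t t.2)
    rw [inv_mul_le_iff₀ hnR]
    linarith
  have hprob (t : ℕ) : μ {ω | ENNReal.ofReal (η * n) ≤ ENNReal.ofReal (f t ω)} = μ (A n) :=
    (hid t).measure_mem_eq (s := {r : ℝ | ENNReal.ofReal (η * n) ≤ ENNReal.ofReal r})
      (measurableSet_le measurable_const ENNReal.measurable_ofReal)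
  calc
    _ ≤ ∑ t ∈ Finset.range n, μ {ω | ENNReal.ofReal (η * n) ≤ ENNReal.ofReal (f t ω)} :=
      (measure_mono hsub).trans (measure_biUnion_finset_le _ _)
    _ = n * μ (A n) := by simp [hprob]
    _ = (ENNReal.ofReal η)⁻¹ * (ENNReal.ofReal (η * n) * μ (A n)) := by
      rw [ENNReal.ofReal_mul hη0.le, ← mul_assoc, ← mul_assoc,
        ENNReal.inv_mul_cancel (by simpa using hη0) ENNReal.ofReal_ne_top, one_mul,
        ENNReal.ofReal_natCast]
    _ ≤ _ := by gcongr; exact hAtail n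

end Stationary

/-! ### The sandwich form and moment matrices -/

section Sandwich

variable {p h : ℕ}

/-- The position in the full regressor vector of each coordinate of the regressor vector of the
`i`-th parsimonious regression. -/
def parsEmb (i : Fin h) : Fin p ⊕ Unit → Fin p ⊕ Fin h :=
  Sum.map _root_.id fun _ => i

theorem parsEmb_injective (i : Fin h) : Function.Injective (parsEmb (p := p) i) :=
  Function.Injective.sumMap Function.injective_id (Function.injective_of_subsingleton _)

theorem parsReg_eq_fullReg {Ω : Type*} (z : ℕ → Ω → Fin p → ℝ) (x : ℕ → Ω → Fin h → ℝ)
    (i : Fin h) (t : ℕ) (ω : Ω) (k : Fin p ⊕ Unit) :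
    parsReg z x i t ω k = fullReg z x t ω (parsEmb i k) := by
  cases k <;> rfl

/-- The form `R [Γ_{ii}⁻¹ Λ_{ij} Γ_{jj}⁻¹] R'` as a function of the moment matrices of the full
regressor vector, of which the blocks `Γ_{ij}` and `Λ_{ij}` are submatrices. -/
noncomputable def parsSandwich (Γ Λ : Matrix (Fin p ⊕ Fin h) (Fin p ⊕ Fin h) ℝ) :
    Matrix (Fin h) (Fin h) ℝ :=
  selMatrix p h * sandwichMatrix (fun i j => Γ.submatrix (parsEmb i) (parsEmb j))
    (fun i j => Λ.submatrix (parsEmb i) (parsEmb j)) * (selMatrix p h).transpose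

theorem parsSandwich_apply (Γ Λ : Matrix (Fin p ⊕ Fin h) (Fin p ⊕ Fin h) ℝ) (i j : Fin h) :
    parsSandwich Γ Λ i j = ((Γ.submatrix (parsEmb i) (parsEmb i))⁻¹ *
      Λ.submatrix (parsEmb i) (parsEmb j) * (Γ.submatrix (parsEmb j) (parsEmb j))⁻¹)
        (Sum.inr ()) (Sum.inr ()) := by
  rw [parsSandwich, Matrix.mul_apply]
  simp only [Matrix.mul_apply (M := selMatrix p h)]
  simp [selMatrix, sandwichMatrix]

theorem tendsto_matrix_inv {ι κ : Type*} [Fintype κ] [DecidableEq κ] {l : Filter ι}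
    {A : ι → Matrix κ κ ℝ} {M : Matrix κ κ ℝ} (hA : Tendsto A l (𝓝 M)) (hM : M.det ≠ 0) :
    Tendsto (fun q => (A q)⁻¹) l (𝓝 M⁻¹) := by
  simp only [Matrix.inv_def, Ring.inverse_eq_inv']
  have hdet : Tendsto (fun q => (A q).det) l (𝓝 M.det) :=
    ((continuous_id.matrix_det).tendsto M).comp hA
  have hadj : Tendsto (fun q => (A q).adjugate) l (𝓝 M.adjugate) :=
    ((continuous_id.matrix_adjugate).tendsto M).comp hA
  exact (hdet.inv₀ hM).smul hadj

theorem tendsto_parsSandwich {ι : Type*} {l : Filter ι}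
    {A B : ι → Matrix (Fin p ⊕ Fin h) (Fin p ⊕ Fin h) ℝ}
    {Γ Λ : Matrix (Fin p ⊕ Fin h) (Fin p ⊕ Fin h) ℝ} (hA : Tendsto A l (𝓝 Γ))
    (hB : Tendsto B l (𝓝 Λ)) (hΓ : Γ.PosDef) (i j : Fin h) :
    Tendsto (fun q => parsSandwich (A q) (B q) i j) l (𝓝 (parsSandwich Γ Λ i j)) := by
  simp only [parsSandwich_apply]
  have hsub (C : ι → Matrix (Fin p ⊕ Fin h) (Fin p ⊕ Fin h) ℝ) (M) (hC : Tendsto C l (𝓝 M))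
      (i j : Fin h) : Tendsto (fun q => (C q).submatrix (parsEmb i) (parsEmb j)) l
        (𝓝 (M.submatrix (parsEmb i) (parsEmb j))) :=
    ((continuous_id.matrix_submatrix _ _).tendsto M).comp hC
  have hinv (i : Fin h) := tendsto_matrix_inv (hsub A Γ hA i i)
    (hΓ.submatrix (parsEmb_injective i)).det_pos.ne'
  have := ((hinv i).mul (hsub B Λ hB i j)).mul (hinv j)
  exact tendsto_pi_nhds.1 (tendsto_pi_nhds.1 this _) _

/-- The sandwich form equals `G' Λ G`, where the `i`-th column of `G` holds the last column of
`Γ_{ii}⁻¹`, spread over the positions of the `i`-th regressor vector. The `x`-rows of `G` are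
diagonal with positive entries, so `G` is injective. -/
theorem posDef_parsSandwich {Γ Λ : Matrix (Fin p ⊕ Fin h) (Fin p ⊕ Fin h) ℝ} (hΓ : Γ.PosDef)
    (hΛ : Λ.PosDef) : (parsSandwich Γ Λ).PosDef := by
  set g : Fin h → Fin p ⊕ Unit → ℝ :=
    fun i k => (Γ.submatrix (parsEmb i) (parsEmb i))⁻¹ k (Sum.inr ()) with hg
  have hΓi (i : Fin h) : ((Γ.submatrix (parsEmb i) (parsEmb i))⁻¹).PosDef :=
    (hΓ.submatrix (parsEmb_injective i)).inv
  set G : Matrix (Fin p ⊕ Fin h) (Fin h) ℝ :=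
    Matrix.of fun m i => ∑ k, if m = parsEmb i k then g i k else 0 with hG
  have hGr (i i' : Fin h) : G (Sum.inr i') i = if i' = i then g i (Sum.inr ()) else 0 := by
    simp [hG, parsEmb]
  have hGsum (f : Fin p ⊕ Fin h → ℝ) (i : Fin h) :
      ∑ m, G m i * f m = ∑ k, g i k * f (parsEmb i k) := by
    simp only [hG, Matrix.of_apply, Finset.sum_mul, ite_mul, zero_mul]
    rw [Finset.sum_comm]
    simp
  have heq : parsSandwich Γ Λ = G.conjTranspose * Λ * G := by
    ext i j
    have hsymm (k : Fin p ⊕ Unit) :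
        (Γ.submatrix (parsEmb i) (parsEmb i))⁻¹ (Sum.inr ()) k = g i k := by
      have := (hΓi i).isHermitian.apply k (Sum.inr ())
      simpa using this
    rw [parsSandwich_apply, Matrix.mul_assoc, Matrix.mul_assoc, Matrix.mul_apply, Matrix.mul_apply]
    simp only [Matrix.conjTranspose_apply, star_trivial]
    rw [hGsum]
    refine Finset.sum_congr rfl fun k _ => ?_
    rw [hsymm, Matrix.mul_apply, Matrix.mul_apply]
    congr 1
    simp only [mul_comm (Λ _ _)]
    rw [hGsum]
    exact Finset.sum_congr rfl fun l _ => by rw [mul_comm]; rfl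
  rw [heq]
  refine hΛ.conjTranspose_mul_mul_same fun v v' hv => ?_
  ext i
  have := congrFun hv (Sum.inr i)
  simp only [Matrix.mulVec, dotProduct, hGr, ite_mul, zero_mul, Finset.sum_ite_eq, Finset.mem_univ,
    if_true] at this
  exact mul_left_cancel₀ ((hΓi i).diag_pos (i := Sum.inr ())).ne' this

end Sandwich

section Moment

variable {Ω κ : Type*} [MeasurableSpace Ω] {μ : Measure Ω}

/-- The second moment matrix `E[f f']` of a random vector `f`. -/
noncomputable def momentMatrix (μ : Measure Ω) (f : Ω → κ → ℝ) : Matrix κ κ ℝ :=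
  Matrix.of fun k l => ∫ ω, f ω k * f ω l ∂μ

variable {f : Ω → κ → ℝ}

theorem isHermitian_momentMatrix : (momentMatrix μ f).IsHermitian := by
  ext k l
  simp [momentMatrix, mul_comm]

variable [Fintype κ]

theorem sq_dotProduct (v w : κ → ℝ) :
    (v ⬝ᵥ w) ^ 2 = ∑ k, ∑ l, v k * v l * (w k * w l) := by
  rw [sq, dotProduct, Finset.sum_mul_sum]
  exact Finset.sum_congr rfl fun k _ => Finset.sum_congr rfl fun l _ => by ring

theorem integrable_sq_dotProduct (hf : ∀ k l, Integrable (fun ω => f ω k * f ω l) μ)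
    (v : κ → ℝ) : Integrable (fun ω => (v ⬝ᵥ f ω) ^ 2) μ := by
  simp only [sq_dotProduct]
  exact integrable_finsetSum _ fun k _ => integrable_finsetSum _ fun l _ => (hf k l).const_mul _

theorem dotProduct_momentMatrix_mulVec (hf : ∀ k l, Integrable (fun ω => f ω k * f ω l) μ)
    (v : κ → ℝ) : v ⬝ᵥ (momentMatrix μ f).mulVec v = ∫ ω, (v ⬝ᵥ f ω) ^ 2 ∂μ := by
  simp only [sq_dotProduct]
  rw [integral_finsetSum _ fun k _ => integrable_finsetSum _ fun l _ => (hf k l).const_mul _]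
  refine Finset.sum_congr rfl fun k _ => ?_
  rw [integral_finsetSum _ fun l _ => (hf k l).const_mul _, Matrix.mulVec, dotProduct,
    Finset.mul_sum]
  refine Finset.sum_congr rfl fun l _ => ?_
  rw [integral_const_mul]
  simp only [momentMatrix, Matrix.of_apply]
  ring

theorem posSemidef_momentMatrix (hf : ∀ k l, Integrable (fun ω => f ω k * f ω l) μ) :
    (momentMatrix μ f).PosSemidef := by
  refine Matrix.PosSemidef.of_dotProduct_mulVec_nonneg isHermitian_momentMatrix fun v => ?_
  rw [star_trivial, dotProduct_momentMatrix_mulVec hf]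
  exact integral_nonneg fun _ => sq_nonneg _

theorem posDef_momentMatrix (hf : ∀ k l, Integrable (fun ω => f ω k * f ω l) μ)
    (h : ∀ v : κ → ℝ, (∀ᵐ ω ∂μ, v ⬝ᵥ f ω = 0) → v = 0) : (momentMatrix μ f).PosDef := by
  refine Matrix.PosDef.of_dotProduct_mulVec_pos isHermitian_momentMatrix fun v hv => ?_
  rw [star_trivial, dotProduct_momentMatrix_mulVec hf]
  refine lt_of_le_of_ne (integral_nonneg fun _ => sq_nonneg _) fun h0 => hv (h v ?_)
  have := (integral_eq_zero_iff_of_nonneg (fun _ => sq_nonneg _)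
    (integrable_sq_dotProduct hf v)).1 h0.symm
  filter_upwards [this] with ω hω
  simpa using hω

end Moment

/-! ### Sample moments and the restricted estimator -/

section SampleMoment

variable {Ω κ : Type*} {p h : ℕ}

/-- The sample second moment matrix `n⁻¹ ∑_t f_t f_t'`. -/
noncomputable def sampleMoment (f : ℕ → Ω → κ → ℝ) (n : ℕ) (ω : Ω) : Matrix κ κ ℝ :=
  Matrix.of fun k l => (n : ℝ)⁻¹ * ∑ t ∈ Finset.range n, f t ω k * f t ω l

theorem sampleMoment_eq_submatrix (z : ℕ → Ω → Fin p → ℝ) (x : ℕ → Ω → Fin h → ℝ) (n : ℕ)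
    (ω : Ω) : sampleMoment z n ω = (sampleMoment (fullReg z x) n ω).submatrix Sum.inl Sum.inl :=
  rfl

theorem estV_eq_parsSandwich (z : ℕ → Ω → Fin p → ℝ) (x : ℕ → Ω → Fin h → ℝ) (y : ℕ → Ω → ℝ)
    (n : ℕ) (ω : Ω) :
    estV z x y n ω = parsSandwich (sampleMoment (fullReg z x) n ω)
      (sampleMoment (fun t ω k => restrictedResid z y n t ω * fullReg z x t ω k) n ω) := by
  rw [estV, parsSandwich]
  congr 3
  · ext i j k l
    simp [sampleGamma, sampleMoment, Matrix.sum_apply, Matrix.vecMulVec_apply, parsReg_eq_fullReg]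
  · ext i j k l
    simp only [sampleLambda, sampleMoment, Matrix.smul_apply, Matrix.sum_apply,
      Matrix.vecMulVec_apply, parsReg_eq_fullReg, smul_eq_mul, Matrix.submatrix_apply,
      Matrix.of_apply]
    congr 1
    exact Finset.sum_congr rfl fun t _ => by ring

theorem popLambda_eq_submatrix [MeasurableSpace Ω] (μ : Measure Ω) (z : ℕ → Ω → Fin p → ℝ)
    (x : ℕ → Ω → Fin h → ℝ) (ε : ℕ → Ω → ℝ) (i j : Fin h) :
    popLambda μ z x ε i j = (popLambdaFull μ z x ε).submatrix (parsEmb i) (parsEmb j) := by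
  ext k l
  simp [popLambda, popLambdaFull, parsReg_eq_fullReg]

theorem popV_eq_parsSandwich [MeasurableSpace Ω] (μ : Measure Ω) (z : ℕ → Ω → Fin p → ℝ)
    (x : ℕ → Ω → Fin h → ℝ) (ε : ℕ → Ω → ℝ) :
    popV μ z x ε =
      parsSandwich (momentMatrix μ (fullReg z x 0)) (popLambdaFull μ z x ε) := by
  rw [popV, parsSandwich]
  congr 3
  · ext i j k l
    simp [popGamma, momentMatrix, parsReg_eq_fullReg]
  · ext i j : 2
    exact popLambda_eq_submatrix μ z x ε i j

theorem popLambdaFull_eq_momentMatrix [MeasurableSpace Ω] (μ : Measure Ω)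
    (z : ℕ → Ω → Fin p → ℝ) (x : ℕ → Ω → Fin h → ℝ) (ε : ℕ → Ω → ℝ) :
    popLambdaFull μ z x ε = momentMatrix μ fun ω k => ε 0 ω * fullReg z x 0 ω k := by
  ext k l
  simp only [popLambdaFull, momentMatrix, Matrix.of_apply]
  congr 1 with ω
  ring

/-- The estimation error of the restricted least squares estimator about an arbitrary `α`. -/
theorem restrictedOLS_sub (z : ℕ → Ω → Fin p → ℝ) (y : ℕ → Ω → ℝ) {n : ℕ} (hn : n ≠ 0) {ω : Ω}
    (hdet : (sampleMoment z n ω).det ≠ 0) (α : Fin p → ℝ) :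
    restrictedOLS z y n ω - α = (sampleMoment z n ω)⁻¹.mulVec fun k =>
      (n : ℝ)⁻¹ * ∑ t ∈ Finset.range n, (y t ω - z t ω ⬝ᵥ α) * z t ω k := by
  set Q : Matrix (Fin p) (Fin p) ℝ := ∑ t ∈ Finset.range n, Matrix.vecMulVec (z t ω) (z t ω)
    with hQ
  have hn' : (n : ℝ) ≠ 0 := Nat.cast_ne_zero.2 hn
  have hS : sampleMoment z n ω = (n : ℝ)⁻¹ • Q := by
    ext k l
    simp [sampleMoment, hQ, Matrix.sum_apply, Matrix.vecMulVec_apply]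
  have hu : IsUnit (sampleMoment z n ω).det := isUnit_iff_ne_zero.2 hdet
  have hQu : IsUnit Q.det := by
    rw [hS, Matrix.det_smul] at hu
    exact isUnit_of_mul_isUnit_right hu
  have hinv : (sampleMoment z n ω)⁻¹ = (n : ℝ) • Q⁻¹ := by
    refine Matrix.inv_eq_right_inv ?_
    rw [hS, Matrix.smul_mul, Matrix.mul_smul, smul_smul, inv_mul_cancel₀ hn', one_smul,
      Matrix.mul_nonsing_inv _ hQu]
  have hr : (fun k => (n : ℝ)⁻¹ * ∑ t ∈ Finset.range n, (y t ω - z t ω ⬝ᵥ α) * z t ω k) =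
      (n : ℝ)⁻¹ • (∑ t ∈ Finset.range n, y t ω • z t ω - Q.mulVec α) := by
    ext k
    have hQα : Q.mulVec α k = ∑ t ∈ Finset.range n, (z t ω ⬝ᵥ α) * z t ω k := by
      rw [hQ, Matrix.sum_mulVec, Finset.sum_apply]
      refine Finset.sum_congr rfl fun t _ => ?_
      rw [Matrix.vecMulVec_mulVec]
      simp [mul_comm]
    rw [Pi.smul_apply, Pi.sub_apply, hQα, Finset.sum_apply, ← Finset.sum_sub_distrib, smul_eq_mul]
    congr 1
    exact Finset.sum_congr rfl fun t _ => by simp [sub_mul]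
  rw [hr, hinv, Matrix.smul_mulVec, Matrix.mulVec_smul, smul_smul, mul_inv_cancel₀ hn', one_smul,
    Matrix.mulVec_sub, Matrix.mulVec_mulVec, Matrix.nonsing_inv_mul _ hQu, Matrix.one_mulVec]
  rfl

theorem sq_dotProduct_le [Fintype κ] (v w : κ → ℝ) : (v ⬝ᵥ w) ^ 2 ≤ (v ⬝ᵥ v) * (w ⬝ᵥ w) := by
  simpa [dotProduct, sq] using Finset.sum_mul_sq_le_sq_mul_sq Finset.univ v w

theorem zero_le_dotProduct_self [Fintype κ] (v : κ → ℝ) : 0 ≤ v ⬝ᵥ v :=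
  Finset.sum_nonneg fun _ _ => mul_self_nonneg _

theorem abs_mul_le_dotProduct_self [Fintype κ] (v : κ → ℝ) (k l : κ) :
    |v k * v l| ≤ v ⬝ᵥ v := by
  have hk (k : κ) : v k ^ 2 ≤ v ⬝ᵥ v := by
    rw [sq]
    exact Finset.single_le_sum (f := fun k => v k * v k) (fun _ _ => mul_self_nonneg _)
      (Finset.mem_univ k)
  rw [abs_mul]
  nlinarith [hk k, hk l, sq_nonneg (|v k| - |v l|), sq_abs (v k), sq_abs (v l)]

theorem dotProduct_mulVec_self_le [Fintype κ] (M : Matrix κ κ ℝ) (v : κ → ℝ) :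
    M.mulVec v ⬝ᵥ M.mulVec v ≤ (∑ k, M k ⬝ᵥ M k) * (v ⬝ᵥ v) := by
  rw [dotProduct, Finset.sum_mul]
  refine Finset.sum_le_sum fun k _ => ?_
  rw [← sq]
  exact sq_dotProduct_le (M k) v

/-- Replacing the weights `u` by `u - d` changes a weighted sample moment by an amount that is
small with `n⁻¹ ∑ d_t² |f_t|²`; the cross term is bounded by the Cauchy–Schwarz inequality. -/
theorem abs_sampleMoment_sub_le [Fintype κ] (f : ℕ → Ω → κ → ℝ) (u d : ℕ → Ω → ℝ) (n : ℕ) (ω : Ω)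
    (k l : κ) :
    |sampleMoment (fun t ω k => (u t ω - d t ω) * f t ω k) n ω k l -
        sampleMoment (fun t ω k => u t ω * f t ω k) n ω k l| ≤
      2 * (√((n : ℝ)⁻¹ * ∑ t ∈ Finset.range n, u t ω ^ 2 * (f t ω ⬝ᵥ f t ω)) *
          √((n : ℝ)⁻¹ * ∑ t ∈ Finset.range n, d t ω ^ 2 * (f t ω ⬝ᵥ f t ω))) +
        (n : ℝ)⁻¹ * ∑ t ∈ Finset.range n, d t ω ^ 2 * (f t ω ⬝ᵥ f t ω) := by
  have hn : (0 : ℝ) ≤ (n : ℝ)⁻¹ := by positivity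
  have hf (t : ℕ) : 0 ≤ f t ω ⬝ᵥ f t ω := zero_le_dotProduct_self _
  have hcs := Real.sum_mul_le_sqrt_mul_sqrt (Finset.range n)
    (fun t => |u t ω| * √(f t ω ⬝ᵥ f t ω)) (fun t => |d t ω| * √(f t ω ⬝ᵥ f t ω))
  simp only [mul_pow, sq_abs, Real.sq_sqrt (hf _)] at hcs
  rw [Real.sqrt_mul hn, Real.sqrt_mul hn, mul_mul_mul_comm, Real.mul_self_sqrt hn]
  simp only [sampleMoment, Matrix.of_apply]
  rw [← mul_sub, ← Finset.sum_sub_distrib, abs_mul, abs_of_nonneg hn]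
  calc
    _ ≤ (n : ℝ)⁻¹ * ∑ t ∈ Finset.range n,
        (2 * ((|u t ω| * √(f t ω ⬝ᵥ f t ω)) * (|d t ω| * √(f t ω ⬝ᵥ f t ω))) +
          d t ω ^ 2 * (f t ω ⬝ᵥ f t ω)) := by
      gcongr
      refine (Finset.abs_sum_le_sum_abs _ _).trans (Finset.sum_le_sum fun t _ => ?_)
      calc
        _ = |(d t ω ^ 2 - 2 * (u t ω * d t ω))| * |f t ω k * f t ω l| := by
          rw [← abs_mul]
          congr 1
          ring
        _ ≤ (2 * (|u t ω| * |d t ω|) + d t ω ^ 2) * (f t ω ⬝ᵥ f t ω) := by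
          gcongr
          · rw [← abs_mul, add_comm]
            refine (abs_sub_le (d t ω ^ 2) 0 (2 * (u t ω * d t ω))).trans (le_of_eq ?_)
            simp [abs_mul]
          · exact abs_mul_le_dotProduct_self _ _ _
        _ = _ := by
          nth_rewrite 1 [← Real.mul_self_sqrt (hf t)]
          nth_rewrite 5 [← Real.mul_self_sqrt (hf t)]
          ring
    _ = 2 * ((n : ℝ)⁻¹ * ∑ t ∈ Finset.range n,
          (|u t ω| * √(f t ω ⬝ᵥ f t ω)) * (|d t ω| * √(f t ω ⬝ᵥ f t ω))) +
        (n : ℝ)⁻¹ * ∑ t ∈ Finset.range n, d t ω ^ 2 * (f t ω ⬝ᵥ f t ω) := by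
      rw [Finset.sum_add_distrib, ← Finset.mul_sum]
      ring
    _ ≤ _ := by gcongr

end SampleMoment

/-! ### Consequences of the assumptions -/

section MartingaleDifference

variable {Ω : Type*} {m m₀ : MeasurableSpace Ω} {μ : Measure Ω}

theorem integral_mul_eq_zero_of_condExp (hm : m ≤ m₀) [SigmaFinite (μ.trim hm)] {f e : Ω → ℝ}
    (hf : StronglyMeasurable[m] f) (he : Integrable e μ) (hfe : Integrable (fun ω => f ω * e ω) μ)
    (h : μ[e | m] =ᵐ[μ] 0) : ∫ ω, f ω * e ω ∂μ = 0 := by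
  have h1 : μ[f * e | m] =ᵐ[μ] f * μ[e | m] := condExp_mul_of_stronglyMeasurable_left hf hfe he
  calc
    ∫ ω, f ω * e ω ∂μ = ∫ ω, (μ[f * e | m]) ω ∂μ := (integral_condExp hm).symm
    _ = ∫ _, 0 ∂μ := by
      refine integral_congr_ae ?_
      filter_upwards [h1, h] with ω h1 h2
      simp [h1, h2]
    _ = 0 := by simp

theorem integral_sq_sum_of_orthogonal {ξ : ℕ → Ω → ℝ}
    (hξ : ∀ t, MemLp (ξ t) 2 μ) (horth : ∀ s t, s < t → ∫ ω, ξ s ω * ξ t ω ∂μ = 0) (n : ℕ) :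
    ∫ ω, (∑ t ∈ Finset.range n, ξ t ω) ^ 2 ∂μ = ∑ t ∈ Finset.range n, ∫ ω, ξ t ω ^ 2 ∂μ := by
  induction n with
  | zero => simp
  | succ n ih =>
    have hS : MemLp (fun ω => ∑ t ∈ Finset.range n, ξ t ω) 2 μ := memLp_finsetSum _ fun t _ => hξ t
    have hcross : Integrable (fun ω => (∑ t ∈ Finset.range n, ξ t ω) * ξ n ω) μ :=
      hS.integrable_mul (hξ n)
    have hzero : ∫ ω, (∑ t ∈ Finset.range n, ξ t ω) * ξ n ω ∂μ = 0 := by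
      simp only [Finset.sum_mul]
      rw [integral_finsetSum (f := fun t ω => ξ t ω * ξ n ω) _ fun t _ =>
        (hξ t).integrable_mul (hξ n)]
      exact Finset.sum_eq_zero fun t ht => horth t n (Finset.mem_range.1 ht)
    have hexp (ω : Ω) : (∑ t ∈ Finset.range (n + 1), ξ t ω) ^ 2 =
        (∑ t ∈ Finset.range n, ξ t ω) ^ 2 + 2 * ((∑ t ∈ Finset.range n, ξ t ω) * ξ n ω) +
          ξ n ω ^ 2 := by
      rw [Finset.sum_range_succ]
      ring
    simp only [hexp]
    have hadd : Integrable (fun ω => (∑ t ∈ Finset.range n, ξ t ω) ^ 2 +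
        2 * ((∑ t ∈ Finset.range n, ξ t ω) * ξ n ω)) μ :=
      hS.integrable_sq.add (hcross.const_mul 2)
    rw [integral_add hadd (hξ n).integrable_sq,
      integral_add hS.integrable_sq (hcross.const_mul 2), integral_const_mul, hzero, ih,
      Finset.sum_range_succ]
    ring

end MartingaleDifference

section Model

variable {Ω : Type*} [MeasurableSpace Ω] {μ : Measure Ω} {p h : ℕ}
  {z : ℕ → Ω → Fin p → ℝ} {x : ℕ → Ω → Fin h → ℝ} {ε y : ℕ → Ω → ℝ}
  {a : Fin p → ℝ} {b : Fin h → ℝ}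

namespace Assumptions

theorem measurable_fullReg (hA : Assumptions μ z x ε y a b) (t : ℕ) :
    Measurable (fullReg z x t) :=
  measurable_pi_lambda _ fun
    | Sum.inl k => (measurable_pi_apply k).comp (hA.measurable_z t)
    | Sum.inr k => (measurable_pi_apply k).comp (hA.measurable_x t)

theorem measurable_process (hA : Assumptions μ z x ε y a b) (t : ℕ) :
    Measurable fun ω => (fullReg z x t ω, ε t ω) :=
  (hA.measurable_fullReg t).prodMk (hA.measurable_err t)

theorem identDistrib (hA : Assumptions μ z x ε y a b) {E : Type*} [MeasurableSpace E]
    {g : (Fin p ⊕ Fin h → ℝ) × ℝ → E} (hg : Measurable g) (t : ℕ) :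
    ProbabilityTheory.IdentDistrib (fun ω => g (fullReg z x t ω, ε t ω))
      (fun ω => g (fullReg z x 0 ω, ε 0 ω)) μ μ :=
  (hA.stationaryErgodic.identDistrib hA.measurable_process t).comp hg

theorem tendsto_sampleMean [IsProbabilityMeasure μ] (hA : Assumptions μ z x ε y a b)
    {g : (Fin p ⊕ Fin h → ℝ) × ℝ → ℝ} (hg : Measurable g)
    (hgi : Integrable (fun ω => g (fullReg z x 0 ω, ε 0 ω)) μ) :
    Tendsto (fun q : ℕ × Ω => (q.1 : ℝ)⁻¹ *
        ∑ t ∈ Finset.range q.1, g (fullReg z x t q.2, ε t q.2)) (probFilter μ)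
      (𝓝 (∫ ω, g (fullReg z x 0 ω, ε 0 ω) ∂μ)) :=
  hA.stationaryErgodic.tendsto_sampleMean hA.measurable_process hg hgi

theorem tendsto_sampleMoment [IsProbabilityMeasure μ] (hA : Assumptions μ z x ε y a b)
    {g : (Fin p ⊕ Fin h → ℝ) × ℝ → ℝ} (hg : Measurable g)
    (hgi : ∀ k l, Integrable (fun ω => (g (fullReg z x 0 ω, ε 0 ω) * fullReg z x 0 ω k) *
      (g (fullReg z x 0 ω, ε 0 ω) * fullReg z x 0 ω l)) μ) :
    Tendsto (fun q : ℕ × Ω => sampleMoment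
        (fun t ω k => g (fullReg z x t ω, ε t ω) * fullReg z x t ω k) q.1 q.2) (probFilter μ)
      (𝓝 (momentMatrix μ fun ω k => g (fullReg z x 0 ω, ε 0 ω) * fullReg z x 0 ω k)) := by
  refine tendsto_pi_nhds.2 fun k => tendsto_pi_nhds.2 fun l => ?_
  have hk (k : Fin p ⊕ Fin h) : Measurable fun s : (Fin p ⊕ Fin h → ℝ) × ℝ => g s * s.1 k :=
    hg.mul ((measurable_pi_apply k).comp measurable_fst)
  have := hA.tendsto_sampleMean (g := fun s => (g s * s.1 k) * (g s * s.1 l))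
    ((hk k).mul (hk l)) (hgi k l)
  simpa only [sampleMoment, momentMatrix, Matrix.of_apply] using this

theorem tendsto_sampleMoment_fullReg [IsProbabilityMeasure μ] (hA : Assumptions μ z x ε y a b) :
    Tendsto (fun q : ℕ × Ω => sampleMoment (fullReg z x) q.1 q.2) (probFilter μ)
      (𝓝 (momentMatrix μ (fullReg z x 0))) := by
  have := hA.tendsto_sampleMoment (g := fun _ => 1) measurable_const
    (by simpa using hA.integrable_sq 0)
  simpa using this

/-- A linear relation between the regressors at time zero would hold at all times by stationarity,
which the full rank of the design matrix excludes. -/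
theorem posDef_momentMatrix [IsProbabilityMeasure μ] (hA : Assumptions μ z x ε y a b) :
    (momentMatrix μ (fullReg z x 0)).PosDef := by
  refine MaxTest.posDef_momentMatrix (hA.integrable_sq 0) fun v hv => ?_
  have hvt (t : ℕ) : ∀ᵐ ω ∂μ, v ⬝ᵥ fullReg z x t ω = 0 := by
    have hm : Measurable fun s : (Fin p ⊕ Fin h → ℝ) × ℝ => v ⬝ᵥ s.1 := by
      unfold dotProduct
      fun_prop
    exact (hA.identDistrib hm t).symm.ae_mem_snd (t := {0}) (measurableSet_singleton 0) hv
  obtain ⟨n, hn⟩ := hA.fullRank.exists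
  obtain ⟨ω, hrank, hω⟩ := (hn.and (ae_all_iff.2 hvt)).exists
  set D := designMatrix z x n ω with hD
  have hDv : D.mulVec v = 0 := by
    ext t
    simpa [hD, designMatrix, Matrix.mulVec, dotProduct_comm] using hω t
  have hinj : Function.Injective D.mulVecLin := by
    rw [← LinearMap.ker_eq_bot, ← Submodule.finrank_eq_zero (R := ℝ)]
    have h1 := LinearMap.finrank_range_add_finrank_ker D.mulVecLin
    rw [← Matrix.rank, hrank] at h1
    simpa using h1
  exact hinj (by simpa using hDv)

theorem integrable_err (hA : Assumptions μ z x ε y a b) [IsFiniteMeasure μ] (t : ℕ) :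
    Integrable (ε t) μ :=
  (hA.memLp_err t).integrable one_le_two

/-- The error is uncorrelated with every function of the contemporaneous regressors. -/
theorem integral_mul_err [IsFiniteMeasure μ] (hA : Assumptions μ z x ε y a b) (t : ℕ)
    {g : (Fin p ⊕ Fin h → ℝ) → ℝ} (hg : Measurable g)
    (hgi : Integrable (fun ω => g (fullReg z x t ω) * ε t ω) μ) :
    ∫ ω, g (fullReg z x t ω) * ε t ω ∂μ = 0 := by
  obtain ⟨𝓕, hz, hx, -, hε⟩ := hA.martingaleDiff
  have hX : Measurable[𝓕 t] (fullReg z x t) := by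
    refine @measurable_pi_lambda Ω _ _ (𝓕 t) _ _ fun k => ?_
    cases k with
    | inl k => exact (measurable_pi_apply k).comp (hz t)
    | inr k => exact (measurable_pi_apply k).comp (hx t)
  exact integral_mul_eq_zero_of_condExp (𝓕.le t) (hg.comp hX).stronglyMeasurable
    (hA.integrable_err t) hgi (hε t)

theorem memLp_err_mul (hA : Assumptions μ z x ε y a b) (t : ℕ) (k : Fin p ⊕ Fin h) :
    MemLp (fun ω => ε t ω * fullReg z x t ω k) 2 μ := by
  have hm : Measurable fun ω => ε t ω * fullReg z x t ω k := (hA.measurable_err t).mul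
    ((measurable_pi_apply k).comp (hA.measurable_fullReg t))
  refine (memLp_two_iff_integrable_sq hm.aestronglyMeasurable).2 ?_
  refine (hA.integrable_err_sq t k k).congr (ae_of_all _ fun ω => ?_)
  simp only
  ring

theorem integral_err_mul_orthogonal [IsFiniteMeasure μ] (hA : Assumptions μ z x ε y a b)
    (k : Fin p ⊕ Fin h) {s t : ℕ} (hst : s < t) :
    ∫ ω, (ε s ω * fullReg z x s ω k) * (ε t ω * fullReg z x t ω k) ∂μ = 0 := by
  obtain ⟨𝓕, hz, hx, he, hε⟩ := hA.martingaleDiff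
  have hX (r : ℕ) : Measurable[𝓕 r] fun ω => fullReg z x r ω k := by
    cases k with
    | inl k => exact (measurable_pi_apply k).comp (hz r)
    | inr k => exact (measurable_pi_apply k).comp (hx r)
  have heq : (fun ω => (ε s ω * fullReg z x s ω k) * (ε t ω * fullReg z x t ω k)) =
      fun ω => (ε s ω * fullReg z x s ω k * fullReg z x t ω k) * ε t ω := by
    ext ω
    ring
  have hint := (hA.memLp_err_mul s k).integrable_mul (hA.memLp_err_mul t k)
  rw [heq]
  refine integral_mul_eq_zero_of_condExp (𝓕.le t) ?_ (hA.integrable_err t) ?_ (hε t)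
  · refine Measurable.stronglyMeasurable ?_
    exact (((he s).mono (𝓕.mono hst) le_rfl).mul ((hX s).mono (𝓕.mono hst.le) le_rfl)).mul (hX t)
  · exact heq ▸ hint

end Assumptions

end Model

/-! ### Limits of the estimator -/

theorem measurable_linear_err (β : Fin p ⊕ Fin h → ℝ) :
    Measurable fun s : (Fin p ⊕ Fin h → ℝ) × ℝ => β ⬝ᵥ s.1 + s.2 := by
  unfold dotProduct
  fun_prop

namespace Assumptions

section Estimator

variable {Ω : Type*} [MeasurableSpace Ω] {μ : Measure Ω} {p h : ℕ}
  {z : ℕ → Ω → Fin p → ℝ} {x : ℕ → Ω → Fin h → ℝ} {ε y : ℕ → Ω → ℝ}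
  {a α : Fin p → ℝ} {b : Fin h → ℝ} {β : Fin p ⊕ Fin h → ℝ}

/-- Suppose that the regression on `z` has the pseudo-true coefficient `α` and pseudo-errors
`u_t = β'X_t + ε_t`. The restricted residuals `u_t - z_t'(α̃_n - α)` may be replaced by the `u_t`
as soon as the weighted mean square of `z_t'(α̃_n - α)` is negligible. -/
theorem tendstoInProb_estV [IsProbabilityMeasure μ] (hA : Assumptions μ z x ε y a b)
    (hu : ∀ t ω, y t ω - z t ω ⬝ᵥ α = β ⬝ᵥ fullReg z x t ω + ε t ω)
    (hui : ∀ k, MemLp (fun ω => (β ⬝ᵥ fullReg z x 0 ω + ε 0 ω) * fullReg z x 0 ω k) 2 μ)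
    (hD : Tendsto (fun q : ℕ × Ω => (q.1 : ℝ)⁻¹ * ∑ t ∈ Finset.range q.1,
      (z t q.2 ⬝ᵥ (restrictedOLS z y q.1 q.2 - α)) ^ 2 *
        (fullReg z x t q.2 ⬝ᵥ fullReg z x t q.2)) (probFilter μ) (𝓝 0)) :
    TendstoInProb μ (estV z x y) (parsSandwich (momentMatrix μ (fullReg z x 0))
      (momentMatrix μ fun ω k => (β ⬝ᵥ fullReg z x 0 ω + ε 0 ω) * fullReg z x 0 ω k)) := by
  intro i j
  rw [tendstoInMeasure_const_iff]
  simp only [estV_eq_parsSandwich]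
  refine tendsto_parsSandwich hA.tendsto_sampleMoment_fullReg ?_ hA.posDef_momentMatrix i j
  set u : ℕ → Ω → ℝ := fun t ω => β ⬝ᵥ fullReg z x t ω + ε t ω with hudef
  have hT : Tendsto (fun q : ℕ × Ω => sampleMoment (fun t ω k => u t ω * fullReg z x t ω k) q.1 q.2)
      (probFilter μ) (𝓝 (momentMatrix μ fun ω k => u 0 ω * fullReg z x 0 ω k)) :=
    hA.tendsto_sampleMoment (g := fun s => β ⬝ᵥ s.1 + s.2) (measurable_linear_err β)
      fun k l => (hui k).integrable_mul (hui l)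
  have hres (n t : ℕ) (ω : Ω) : restrictedResid z y n t ω =
      u t ω - z t ω ⬝ᵥ (restrictedOLS z y n ω - α) := by
    rw [hudef, restrictedResid, dotProduct_sub]
    simp only
    rw [← hu]
    ring
  -- The weighted mean square of the pseudo-errors is a trace, hence convergent.
  have hU : Tendsto (fun q : ℕ × Ω => (q.1 : ℝ)⁻¹ * ∑ t ∈ Finset.range q.1,
      u t q.2 ^ 2 * (fullReg z x t q.2 ⬝ᵥ fullReg z x t q.2)) (probFilter μ)
      (𝓝 (momentMatrix μ fun ω k => u 0 ω * fullReg z x 0 ω k).trace) := by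
    refine ((continuous_id.matrix_trace.tendsto _).comp hT).congr fun q => ?_
    simp only [Function.comp, _root_.id, Matrix.trace, Matrix.diag, sampleMoment, Matrix.of_apply]
    rw [← Finset.mul_sum, Finset.sum_comm]
    congr 1
    refine Finset.sum_congr rfl fun t _ => ?_
    rw [dotProduct, Finset.mul_sum]
    exact Finset.sum_congr rfl fun k _ => by ring
  refine tendsto_pi_nhds.2 fun k => tendsto_pi_nhds.2 fun l => ?_
  have hTkl := tendsto_pi_nhds.1 (tendsto_pi_nhds.1 hT k) l
  have hbound := ((hU.sqrt.mul hD.sqrt).const_mul 2).add hD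
  simp only [Real.sqrt_zero, mul_zero, add_zero] at hbound
  refine (tendsto_iff_of_dist (squeeze_zero (fun _ => dist_nonneg) (fun q => ?_) hbound)).1 hTkl
  rw [dist_comm, Real.dist_eq]
  simp only [hres]
  exact abs_sampleMoment_sub_le (fullReg z x) u
    (fun t ω => z t ω ⬝ᵥ (restrictedOLS z y q.1 ω - α)) q.1 q.2 k l

/-- By the Cauchy–Schwarz inequality, the weighted mean square of `z_t'(α̃_n - α)` is negligible if
the squared length of the score `n⁻¹ ∑ z_t (y_t - z_t'α)` times the sample mean of `|z_t|² |X_t|²`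
is. -/
theorem tendsto_weighted_fit_error [IsProbabilityMeasure μ] (hA : Assumptions μ z x ε y a b)
    {r : ℕ × Ω → Fin p → ℝ}
    (hr : ∀ q k, r q k =
      (q.1 : ℝ)⁻¹ * ∑ t ∈ Finset.range q.1, (y t q.2 - z t q.2 ⬝ᵥ α) * z t q.2 k)
    (hlim : Tendsto (fun q : ℕ × Ω => (r q ⬝ᵥ r q) * ((q.1 : ℝ)⁻¹ * ∑ t ∈ Finset.range q.1,
      (z t q.2 ⬝ᵥ z t q.2) * (fullReg z x t q.2 ⬝ᵥ fullReg z x t q.2))) (probFilter μ) (𝓝 0)) :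
    Tendsto (fun q : ℕ × Ω => (q.1 : ℝ)⁻¹ * ∑ t ∈ Finset.range q.1,
      (z t q.2 ⬝ᵥ (restrictedOLS z y q.1 q.2 - α)) ^ 2 *
        (fullReg z x t q.2 ⬝ᵥ fullReg z x t q.2)) (probFilter μ) (𝓝 0) := by
  have hQ : Tendsto (fun q : ℕ × Ω => sampleMoment z q.1 q.2) (probFilter μ)
      (𝓝 ((momentMatrix μ (fullReg z x 0)).submatrix Sum.inl Sum.inl)) := by
    simp only [sampleMoment_eq_submatrix z x]
    exact ((continuous_id.matrix_submatrix _ _).tendsto _).comp hA.tendsto_sampleMoment_fullReg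
  have hdet := (hA.posDef_momentMatrix.submatrix
    (Sum.inl_injective (α := Fin p) (β := Fin h))).det_pos.ne'
  have hdetn : ∀ᶠ q in probFilter μ, (sampleMoment z q.1 q.2).det ≠ 0 :=
    ((continuous_id.matrix_det.tendsto _).comp hQ).eventually_ne hdet
  have hinv := tendsto_matrix_inv hQ hdet
  have hF : Tendsto (fun q : ℕ × Ω => ∑ k, (sampleMoment z q.1 q.2)⁻¹ k ⬝ᵥ
      (sampleMoment z q.1 q.2)⁻¹ k) (probFilter μ) (𝓝 (∑ k, _ ⬝ᵥ _)) :=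
    tendsto_finsetSum _ fun k _ => tendsto_finsetSum _ fun l _ =>
      (tendsto_pi_nhds.1 (tendsto_pi_nhds.1 hinv k) l).mul
        (tendsto_pi_nhds.1 (tendsto_pi_nhds.1 hinv k) l)
  have hup := hF.mul hlim
  rw [mul_zero] at hup
  refine tendsto_of_tendsto_of_tendsto_of_le_of_le' tendsto_const_nhds hup
    (.of_forall fun q => ?_) ?_
  · exact mul_nonneg (by positivity) (Finset.sum_nonneg fun t _ =>
      mul_nonneg (sq_nonneg _) (zero_le_dotProduct_self _))
  · filter_upwards [hdetn, tendsto_fst_probFilter.eventually (eventually_ne_atTop 0)] with q hq hn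
    have hrq : (fun k => (q.1 : ℝ)⁻¹ * ∑ t ∈ Finset.range q.1,
        (y t q.2 - z t q.2 ⬝ᵥ α) * z t q.2 k) = r q := (funext (hr q)).symm
    rw [restrictedOLS_sub z y hn hq α, hrq]
    set M := (sampleMoment z q.1 q.2)⁻¹
    calc
      _ ≤ (q.1 : ℝ)⁻¹ * ∑ t ∈ Finset.range q.1, ((∑ k, M k ⬝ᵥ M k) * (r q ⬝ᵥ r q)) *
          ((z t q.2 ⬝ᵥ z t q.2) * (fullReg z x t q.2 ⬝ᵥ fullReg z x t q.2)) := by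
        refine mul_le_mul_of_nonneg_left (Finset.sum_le_sum fun t _ => ?_) (by positivity)
        rw [← mul_assoc]
        refine mul_le_mul_of_nonneg_right ?_ (zero_le_dotProduct_self _)
        rw [mul_comm]
        exact (sq_dotProduct_le _ _).trans (mul_le_mul_of_nonneg_left
          (dotProduct_mulVec_self_le _ _) (zero_le_dotProduct_self _))
      _ = _ := by
        rw [← Finset.mul_sum]
        ring

/-- The regressors are square integrable, so their squared length has a law of large numbers. -/
theorem tendsto_mean_dotProduct_self [IsProbabilityMeasure μ] (hA : Assumptions μ z x ε y a b) :
    Tendsto (fun q : ℕ × Ω => (q.1 : ℝ)⁻¹ * ∑ t ∈ Finset.range q.1,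
      (fullReg z x t q.2 ⬝ᵥ fullReg z x t q.2)) (probFilter μ)
      (𝓝 (∫ ω, fullReg z x 0 ω ⬝ᵥ fullReg z x 0 ω ∂μ)) := by
  refine hA.tendsto_sampleMean (g := fun s => s.1 ⬝ᵥ s.1) ?_
    (integrable_finsetSum _ fun k _ => hA.integrable_sq 0 k k)
  unfold dotProduct
  fun_prop

/-- The squared length of `n⁻¹ ∑ z_t ε_t`, multiplied by `n`, is bounded in mean, because the
`z_t ε_t` are orthogonal. -/
theorem integrable_and_integral_score_le [IsProbabilityMeasure μ]
    (hA : Assumptions μ z x ε y a b) (n : ℕ) :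
    Integrable (fun ω => ∑ k : Fin p,
        (n : ℝ)⁻¹ * (∑ t ∈ Finset.range n, ε t ω * fullReg z x t ω (Sum.inl k)) ^ 2) μ ∧
    ∫ ω, ∑ k : Fin p,
        (n : ℝ)⁻¹ * (∑ t ∈ Finset.range n, ε t ω * fullReg z x t ω (Sum.inl k)) ^ 2 ∂μ ≤
      ∑ k : Fin p, ∫ ω, (ε 0 ω * fullReg z x 0 ω (Sum.inl k)) ^ 2 ∂μ := by
  have hint (k : Fin p) : Integrable (fun ω =>
      (n : ℝ)⁻¹ * (∑ t ∈ Finset.range n, ε t ω * fullReg z x t ω (Sum.inl k)) ^ 2) μ :=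
    ((memLp_finsetSum _ fun t _ => hA.memLp_err_mul t (Sum.inl k)).integrable_sq).const_mul _
  refine ⟨integrable_finsetSum _ fun k _ => hint k, ?_⟩
  rw [integral_finsetSum _ fun k _ => hint k]
  refine Finset.sum_le_sum fun k _ => ?_
  have hconst (t : ℕ) : ∫ ω, (ε t ω * fullReg z x t ω (Sum.inl k)) ^ 2 ∂μ =
      ∫ ω, (ε 0 ω * fullReg z x 0 ω (Sum.inl k)) ^ 2 ∂μ := by
    refine (hA.identDistrib (g := fun s => (s.2 * s.1 (Sum.inl k)) ^ 2) ?_ t).integral_eq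
    fun_prop
  rw [integral_const_mul, integral_sq_sum_of_orthogonal
    (ξ := fun t ω => ε t ω * fullReg z x t ω (Sum.inl k)) (fun t => hA.memLp_err_mul t _)
    fun s t hst => hA.integral_err_mul_orthogonal _ hst]
  simp only [hconst, Finset.sum_const, Finset.card_range, nsmul_eq_mul]
  have h0 : 0 ≤ ∫ ω, (ε 0 ω * fullReg z x 0 ω (Sum.inl k)) ^ 2 ∂μ :=
    integral_nonneg fun _ => sq_nonneg _
  rw [← mul_assoc]
  exact mul_le_of_le_one_left h0 inv_mul_le_one

/-- Only second moments of the regressors are available here: the maximum of `|z_t|²` is `o(n)`,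
while the squared length of the score is of order `n⁻¹`. -/
theorem tendstoInProb_estV_of_eq_zero [IsProbabilityMeasure μ]
    (hA : Assumptions μ z x ε y a 0) : TendstoInProb μ (estV z x y) (popV μ z x ε) := by
  have hu (t : ℕ) (ω : Ω) : y t ω - z t ω ⬝ᵥ a = ε t ω := by
    rw [hA.model]
    simp
  set r : ℕ × Ω → Fin p → ℝ := fun q k =>
    (q.1 : ℝ)⁻¹ * ∑ t ∈ Finset.range q.1, ε t q.2 * fullReg z x t q.2 (Sum.inl k) with hr
  have hzm (t : ℕ) : Measurable fun ω => z t ω ⬝ᵥ z t ω := by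
    have := hA.measurable_z t
    unfold dotProduct
    fun_prop
  have hmax := tendsto_iSup_div_probFilter (μ := μ) (f := fun t ω => z t ω ⬝ᵥ z t ω)
    (fun t ω => zero_le_dotProduct_self _) hzm
    (fun t => hA.identDistrib (g := fun s => ∑ k : Fin p, s.1 (Sum.inl k) * s.1 (Sum.inl k))
      (by fun_prop) t)
    (integrable_finsetSum _ fun k _ => hA.integrable_sq 0 (Sum.inl k) (Sum.inl k))
  have hprod := tendsto_probFilter_mul_of_integral_le hmax
    (s := fun n ω => ∑ k : Fin p,
      (n : ℝ)⁻¹ * (∑ t ∈ Finset.range n, ε t ω * fullReg z x t ω (Sum.inl k)) ^ 2)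
    (fun n ω => Finset.sum_nonneg fun k _ => by positivity)
    (fun n => (hA.integrable_and_integral_score_le n).1)
    (fun n => (hA.integrable_and_integral_score_le n).2)
  have hup := hprod.mul hA.tendsto_mean_dotProduct_self
  rw [zero_mul] at hup
  have hD := hA.tendsto_weighted_fit_error (α := a) (r := r)
      (fun q k => by simp only [hu]; rfl) <| by
    refine tendsto_of_tendsto_of_tendsto_of_le_of_le' tendsto_const_nhds hup
      (.of_forall fun q => ?_) ?_
    · exact mul_nonneg (zero_le_dotProduct_self _) (mul_nonneg (by positivity)
        (Finset.sum_nonneg fun t _ =>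
          mul_nonneg (zero_le_dotProduct_self _) (zero_le_dotProduct_self _)))
    · filter_upwards [tendsto_fst_probFilter.eventually (eventually_ne_atTop 0)] with q hn
      have hn' : (0 : ℝ) < q.1 := by positivity
      set m := ⨆ t : Fin q.1, (q.1 : ℝ)⁻¹ * (z t q.2 ⬝ᵥ z t q.2) with hm
      have hzle (t : ℕ) (ht : t ∈ Finset.range q.1) : z t q.2 ⬝ᵥ z t q.2 ≤ q.1 * m := by
        rw [← inv_mul_le_iff₀ hn']
        exact le_ciSup (f := fun t : Fin q.1 => (q.1 : ℝ)⁻¹ * (z t q.2 ⬝ᵥ z t q.2))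
          (Set.finite_range _).bddAbove ⟨t, Finset.mem_range.1 ht⟩
      have hrr : ∑ k : Fin p, (q.1 : ℝ)⁻¹ *
          (∑ t ∈ Finset.range q.1, ε t q.2 * fullReg z x t q.2 (Sum.inl k)) ^ 2 =
          q.1 * (r q ⬝ᵥ r q) := by
        rw [dotProduct, Finset.mul_sum]
        refine Finset.sum_congr rfl fun k _ => ?_
        simp only [hr]
        field_simp
      rw [hrr]
      calc
        _ ≤ (r q ⬝ᵥ r q) * ((q.1 : ℝ)⁻¹ * ∑ t ∈ Finset.range q.1,
            (q.1 * m) * (fullReg z x t q.2 ⬝ᵥ fullReg z x t q.2)) := by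
          refine mul_le_mul_of_nonneg_left (mul_le_mul_of_nonneg_left
            (Finset.sum_le_sum fun t ht => ?_) (inv_nonneg.2 hn'.le)) (zero_le_dotProduct_self _)
          exact mul_le_mul_of_nonneg_right (hzle t ht) (zero_le_dotProduct_self _)
        _ = _ := by
          rw [← Finset.mul_sum]
          ring
  have := hA.tendstoInProb_estV (α := a) (β := 0) (fun t ω => by simp [hu])
    (fun k => by simpa using hA.memLp_err_mul 0 k) hD
  rw [popV_eq_parsSandwich, popLambdaFull_eq_momentMatrix]
  simpa using this

theorem memLp_mul_of_fourth (hA : Assumptions μ z x ε y a b)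
    (h4 : ∀ t k, Integrable (fun ω => fullReg z x t ω k ^ 4) μ) (t : ℕ) (k l : Fin p ⊕ Fin h) :
    MemLp (fun ω => fullReg z x t ω k * fullReg z x t ω l) 2 μ := by
  have hm (k : Fin p ⊕ Fin h) : Measurable fun ω => fullReg z x t ω k :=
    (measurable_pi_apply k).comp (hA.measurable_fullReg t)
  have hkl : Measurable fun ω => fullReg z x t ω k * fullReg z x t ω l := (hm k).mul (hm l)
  refine (memLp_two_iff_integrable_sq hkl.aestronglyMeasurable).2 ?_
  refine ((h4 t k).add (h4 t l)).mono' (hkl.pow_const 2).aestronglyMeasurable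
    (ae_of_all _ fun ω => ?_)
  rw [Real.norm_of_nonneg (sq_nonneg _), Pi.add_apply]
  nlinarith [sq_nonneg (fullReg z x t ω k ^ 2 - fullReg z x t ω l ^ 2),
    sq_nonneg (fullReg z x t ω k ^ 2), sq_nonneg (fullReg z x t ω l ^ 2)]

theorem memLp_dotProduct_mul (hA : Assumptions μ z x ε y a b)
    (h4 : ∀ t k, Integrable (fun ω => fullReg z x t ω k ^ 4) μ) (β : Fin p ⊕ Fin h → ℝ)
    (k : Fin p ⊕ Fin h) :
    MemLp (fun ω => (β ⬝ᵥ fullReg z x 0 ω) * fullReg z x 0 ω k) 2 μ := by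
  simp only [dotProduct, Finset.sum_mul, mul_assoc]
  exact memLp_finsetSum _ fun l _ => (hA.memLp_mul_of_fourth h4 0 l k).const_mul (β l)

/-- With fourth moments, the weighted pseudo-errors `(β'X + ε) X` have the second moment matrix
`Λ + E[(β'X)² X X']`: the cross terms vanish because the error is a martingale difference. -/
theorem momentMatrix_linear_err [IsProbabilityMeasure μ] (hA : Assumptions μ z x ε y a b)
    (h4 : ∀ t k, Integrable (fun ω => fullReg z x t ω k ^ 4) μ) (β : Fin p ⊕ Fin h → ℝ) :
    (momentMatrix μ fun ω k => (β ⬝ᵥ fullReg z x 0 ω + ε 0 ω) * fullReg z x 0 ω k) =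
      popLambdaFull μ z x ε +
        momentMatrix μ fun ω k => (β ⬝ᵥ fullReg z x 0 ω) * fullReg z x 0 ω k := by
  rw [popLambdaFull_eq_momentMatrix]
  ext k l
  simp only [momentMatrix, Matrix.of_apply, Matrix.add_apply]
  have hee : Integrable (fun ω =>
      (ε 0 ω * fullReg z x 0 ω k) * (ε 0 ω * fullReg z x 0 ω l)) μ :=
    (hA.memLp_err_mul 0 k).integrable_mul (hA.memLp_err_mul 0 l)
  have hbb : Integrable (fun ω =>
      (β ⬝ᵥ fullReg z x 0 ω * fullReg z x 0 ω k) * (β ⬝ᵥ fullReg z x 0 ω * fullReg z x 0 ω l)) μ :=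
    (hA.memLp_dotProduct_mul h4 β k).integrable_mul (hA.memLp_dotProduct_mul h4 β l)
  have hcross : Integrable (fun ω =>
      (β ⬝ᵥ fullReg z x 0 ω * fullReg z x 0 ω k * fullReg z x 0 ω l) * ε 0 ω) μ := by
    refine ((hA.memLp_dotProduct_mul h4 β k).integrable_mul (hA.memLp_err_mul 0 l)).congr
      (ae_of_all _ fun ω => ?_)
    simp only [Pi.mul_apply]
    ring
  have hzero : ∫ ω, (β ⬝ᵥ fullReg z x 0 ω * fullReg z x 0 ω k * fullReg z x 0 ω l) * ε 0 ω ∂μ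
      = 0 := by
    refine hA.integral_mul_err 0 (g := fun v => β ⬝ᵥ v * v k * v l) ?_ hcross
    unfold dotProduct
    fun_prop
  calc
    _ = ∫ ω, ((ε 0 ω * fullReg z x 0 ω k) * (ε 0 ω * fullReg z x 0 ω l) +
          (β ⬝ᵥ fullReg z x 0 ω * fullReg z x 0 ω k) * (β ⬝ᵥ fullReg z x 0 ω * fullReg z x 0 ω l)) +
          2 * ((β ⬝ᵥ fullReg z x 0 ω * fullReg z x 0 ω k * fullReg z x 0 ω l) * ε 0 ω) ∂μ := by
      congr 1 with ω
      ring
    _ = _ := by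
      have hadd : Integrable (fun ω => (ε 0 ω * fullReg z x 0 ω k) * (ε 0 ω * fullReg z x 0 ω l) +
          (β ⬝ᵥ fullReg z x 0 ω * fullReg z x 0 ω k) *
            (β ⬝ᵥ fullReg z x 0 ω * fullReg z x 0 ω l)) μ := hee.add hbb
      rw [integral_add hadd (hcross.const_mul 2), integral_const_mul, hzero, mul_zero,
        add_zero]
      exact integral_add hee hbb

theorem integral_linear_err_mul [IsProbabilityMeasure μ] (hA : Assumptions μ z x ε y a b)
    (β : Fin p ⊕ Fin h → ℝ) (k : Fin p ⊕ Fin h) :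
    Integrable (fun ω => (β ⬝ᵥ fullReg z x 0 ω + ε 0 ω) * fullReg z x 0 ω k) μ ∧
    ∫ ω, (β ⬝ᵥ fullReg z x 0 ω + ε 0 ω) * fullReg z x 0 ω k ∂μ =
      (momentMatrix μ (fullReg z x 0)).mulVec β k := by
  have he : Integrable (fun ω => fullReg z x 0 ω k * ε 0 ω) μ := by
    simpa only [mul_comm] using (hA.memLp_err_mul 0 k).integrable one_le_two
  have hl (l : Fin p ⊕ Fin h) :
      Integrable (fun ω => fullReg z x 0 ω k * fullReg z x 0 ω l * β l) μ :=
    (hA.integrable_sq 0 k l).mul_const _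
  have hexp : (fun ω => (β ⬝ᵥ fullReg z x 0 ω + ε 0 ω) * fullReg z x 0 ω k) = fun ω =>
      (∑ l, fullReg z x 0 ω k * fullReg z x 0 ω l * β l) + fullReg z x 0 ω k * ε 0 ω := by
    ext ω
    rw [add_mul, dotProduct, Finset.sum_mul, mul_comm (ε 0 ω)]
    congr 1
    exact Finset.sum_congr rfl fun l _ => by ring
  have hsum := integrable_finsetSum Finset.univ fun l _ => hl l
  rw [hexp]
  refine ⟨hsum.add he, ?_⟩
  rw [integral_add hsum he, hA.integral_mul_err 0 (g := fun v => v k) (measurable_pi_apply k) he,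
    add_zero, integral_finsetSum _ fun l _ => hl l]
  refine Finset.sum_congr rfl fun l _ => ?_
  rw [integral_mul_const]
  rfl

/-- The pseudo-true value is `α = a + c` with `c = E[zz']⁻¹ E[zx'] b`, the population projection
coefficient; it makes the score have mean zero. -/
theorem exists_tendstoInProb_estV [IsProbabilityMeasure μ] (hA : Assumptions μ z x ε y a b)
    (h4 : ∀ t k, Integrable (fun ω => fullReg z x t ω k ^ 4) μ) :
    ∃ Vbar : Matrix (Fin h) (Fin h) ℝ, TendstoInProb μ (estV z x y) Vbar ∧
      ((popLambdaFull μ z x ε).PosDef → Vbar.PosDef) := by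
  set Γ := momentMatrix μ (fullReg z x 0) with hΓ
  have hΓpd : Γ.PosDef := hA.posDef_momentMatrix
  set c : Fin p → ℝ := Γ.toBlocks₁₁⁻¹.mulVec (Γ.toBlocks₁₂.mulVec b) with hc
  set β : Fin p ⊕ Fin h → ℝ := Sum.elim (-c) b with hβ
  have hu (t : ℕ) (ω : Ω) : y t ω - z t ω ⬝ᵥ (a + c) = β ⬝ᵥ fullReg z x t ω + ε t ω := by
    rw [hA.model, hβ, fullReg, sumElim_dotProduct_sumElim, dotProduct_add, neg_dotProduct,
      dotProduct_comm c, dotProduct_comm b]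
    ring
  have hΓβ (k : Fin p) : Γ.mulVec β (Sum.inl k) = 0 := by
    have hdet : IsUnit Γ.toBlocks₁₁.det := isUnit_iff_ne_zero.2
      (hΓpd.submatrix (Sum.inl_injective (α := Fin p) (β := Fin h))).det_pos.ne'
    rw [← Matrix.fromBlocks_toBlocks Γ, Matrix.fromBlocks_mulVec]
    have h1 : β ∘ Sum.inl = -c := rfl
    have h2 : β ∘ Sum.inr = b := rfl
    rw [h1, h2, Matrix.mulVec_neg, hc, Matrix.mulVec_mulVec, Matrix.mul_nonsing_inv _ hdet,
      Matrix.one_mulVec]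
    simp
  have hui (k : Fin p ⊕ Fin h) :
      MemLp (fun ω => (β ⬝ᵥ fullReg z x 0 ω + ε 0 ω) * fullReg z x 0 ω k) 2 μ := by
    simp only [add_mul]
    exact (hA.memLp_dotProduct_mul h4 β k).add (hA.memLp_err_mul 0 k)
  set r : ℕ × Ω → Fin p → ℝ := fun q k => (q.1 : ℝ)⁻¹ * ∑ t ∈ Finset.range q.1,
    (β ⬝ᵥ fullReg z x t q.2 + ε t q.2) * fullReg z x t q.2 (Sum.inl k) with hr
  have hr0 (k : Fin p) : Tendsto (fun q => r q k) (probFilter μ) (𝓝 0) := by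
    obtain ⟨hi, hv⟩ := hA.integral_linear_err_mul β (Sum.inl k)
    have := hA.tendsto_sampleMean (g := fun s => (β ⬝ᵥ s.1 + s.2) * s.1 (Sum.inl k))
      ((measurable_linear_err β).mul ((measurable_pi_apply _).comp measurable_fst)) hi
    rwa [hv, hΓβ] at this
  have hrr : Tendsto (fun q => r q ⬝ᵥ r q) (probFilter μ) (𝓝 0) := by
    have := tendsto_finsetSum Finset.univ fun k _ => (hr0 k).mul (hr0 k)
    simpa [dotProduct] using this
  have h4mean := hA.tendsto_sampleMean
    (g := fun s => (∑ k : Fin p, s.1 (Sum.inl k) * s.1 (Sum.inl k)) * (∑ l, s.1 l * s.1 l))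
    (by fun_prop) <| by
      simp only [Finset.sum_mul_sum]
      exact integrable_finsetSum _ fun k _ => integrable_finsetSum _ fun l _ =>
        (hA.memLp_mul_of_fourth h4 0 _ _).integrable_mul (hA.memLp_mul_of_fourth h4 0 l l)
  have hlim := hrr.mul h4mean
  rw [zero_mul] at hlim
  have hD := hA.tendsto_weighted_fit_error (α := a + c) (r := r)
    (fun q k => by simp only [hu]; rfl) hlim
  refine ⟨_, hA.tendstoInProb_estV hu hui hD, fun hΛ => posDef_parsSandwich hΓpd ?_⟩
  rw [hA.momentMatrix_linear_err h4 β]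
  exact hΛ.add_posSemidef (posSemidef_momentMatrix fun k l =>
    (hA.memLp_dotProduct_mul h4 β k).integrable_mul (hA.memLp_dotProduct_mul h4 β l))

end Estimator

end Assumptions

end MaxTest

theorem proposition2 {Ω : Type*} [MeasurableSpace Ω] (μ : MeasureTheory.Measure Ω)
    [MeasureTheory.IsProbabilityMeasure μ] {p h : ℕ}
    (z : ℕ → Ω → Fin p → ℝ) (x : ℕ → Ω → Fin h → ℝ) (ε y : ℕ → Ω → ℝ)
    (a : Fin p → ℝ) (b : Fin h → ℝ)
    (hA : MaxTest.Assumptions μ z x ε y a b) :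
    (b = 0 → MaxTest.TendstoInProb μ (MaxTest.estV z x y) (MaxTest.popV μ z x ε)) ∧
    (b ≠ 0 →
      (∀ t k, MeasureTheory.Integrable (fun ω => MaxTest.fullReg z x t ω k ^ 4) μ) →
      ∃ Vbar : Matrix (Fin h) (Fin h) ℝ,
        MaxTest.TendstoInProb μ (MaxTest.estV z x y) Vbar ∧
        ((MaxTest.popLambdaFull μ z x ε).PosDef → Vbar.PosDef)) := by
  refine ⟨?_, fun _ h4 => hA.exists_tendstoInProb_estV h4⟩
  rintro rfl
  exact hA.tendstoInProb_estV_of_eq_zero
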